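/- Let $k$ be a field and $n\ge 1$, and order the monomials of $k[X]=k[X_1,\dots,X_n]$ lexicographically with $X_1\succ X_2\succ\dots\succ X_n$; identify a monomial $X^d$ with its exponent $d\in\mathbb N_0^n$. For a lower set $D\subseteq\mathbb N_0^n$ let $E(D)$ be the set of $\beta\notin D$ such that $\beta-e_i\in D$ whenever $\beta_i\ne 0$. Let $H=\{\langle p_1,D_1\rangle,\dots,\langle p_t,D_t\rangle\}$ be a finite set of distinct points $p_j\in k^n$, each with a finite lower set $D_j\subseteq\mathbb N_0^n$ as its multiplicity structure, let $m=\sum_j\#D_j$, and let $$I(H)=\Big\{f\in k[X] : \frac{\partial^{d_1+\dots+d_n}f}{\partial X_1^{d_1}\cdots\partial X_n^{d_n}}(p_j)=0\ \text{ for all } j \text{ and all } d\in D_j\Big\}.$$ Assume that $\operatorname{char}k=0$ or that $\operatorname{char}k$ is larger than every coordinate of every element of every $D_j$. The lower set $D(H)$ and the polynomial set $\mathrm{poly}(H)$ are defined by induction on $n$. *Case $n=1$.* $D(H)=\{0,1,\dots,m-1\}$ and $\mathrm{poly}(H)=\{\prod_j (X_1-p_j)^{\#D_j}\}$. *Special case: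 $n\ge2$, $m\geq 1$ and all points have the same last coordinate $c$.* Let $w$ be the largest last coordinate of an element of a $D_j$, and for $0\le i\le w$ let $H^{(i)}$ be the set of points in $k^{n-1}$ with multiplicity structures obtained by keeping, for each $j$, the $d\in D_j$ with $d_n=i$, and deleting the last coordinates of points and exponents. Then $D(H)=\bigcup_{i=0}^w D(H^{(i)})\times\{i\}$, and $\mathrm{poly}(H)$ consists of those among the polynomials $(X_n-c)^{w+1}$ and $(X_n-c)^i f$ ($0\le i\le w$, $f\in\mathrm{poly}(H^{(i)})$) whose leading monomial lies in $E(D(H))$. *General case, $n\ge2$.* Split $H$ (without the points whose multiplicity structure is empty) into the fibres $H_1,\dots,H_s$ over the distinct values $c_1,\dots,c_s$ of the last coordinate, in any order, and let $D_i'=D(H_i)$, $G_i=\mathrm{poly}(H_i)$ and $w_i$ be as in the special case. Then $D(H)=D_1'+\dots+D_s'$, where the sum of lower sets is obtained by stacking them along the last axis: for each $b\in\mathbb N_0^{n-1}$, the number of elements of the sum of the form $(b,j)$ is the sum of the corresponding numbers of the summands. The polynomials are obtained by starting with $D=D_1'$, $G=G_1$ and performing, for $i=2,\dots,s$, the following step: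 run through $a\in E(D+D_i')$ in increasing order, starting with $\hat G=\varnothing$. For a lower set $D''$ let $v(a,D'')$ be the least $j$ such that $(a_1,\dots,a_{n-1},j)\notin D''$. Let $f_1$ be a monomial multiple, with leading monomial $(a_1,\dots,a_{n-1},v(a,D))$, of an element of $G$ whose leading monomial is in $E(D)$; let $f_2$ be the analogous polynomial for $D_i',G_i$; let $v_l=v(a,D_l')$; choose $r_1,r_2\in k[X_n]$ with $$r_1(X_n-c_i)^{w_i+1-v_i}+r_2\prod_{l<i}(X_n-c_l)^{w_l+1-v_l}=1;$$ add to $\hat G$ a remainder of $r_1f_1(X_n-c_i)^{w_i+1}+r_2f_2\prod_{l<i}(X_n-c_l)^{w_l+1}$ upon division by $\hat G$. After the last $a$, replace $D$ by $D+D_i'$ and $G$ by $\hat G$. The final $G$ is $\mathrm{poly}(H)$. (If $m=0$, then $D(H)=\varnothing$ and $\mathrm{poly}(H)=\{1\}$.) Theorem. The algorithm can be carried out, and for all choices made in it, $\mathrm{poly}(H)$ is the reduced Gröbner basis of $I(H)$ with respect to the lexicographic order. Moreover $D(H)$ is a lower set and is the quotient basis of $I(H)$: it is the set of monomials that are not leading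 monomials of nonzero elements of $I(H)$, and the classes of its elements form a $k$-basis of $k[X]/I(H)$. Furthermore, $\dim_k k[X]/I(H)=m=\#D(H)$. -/

import Mathlib

open MvPolynomial
open scoped MonomialOrder

noncomputable section

/-- Forgetting the last coordinate of an exponent. -/
def projHat {n : ℕ} (d : Fin (n + 1) →₀ ℕ) : Fin n →₀ ℕ :=
  Finsupp.equivFunOnFinite.symm fun i => d i.castSucc

/-- Appending the last coordinate `c` to an exponent. -/
def embed {n : ℕ} (c : ℕ) (b : Fin n →₀ ℕ) : Fin (n + 1) →₀ ℕ :=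
  Finsupp.equivFunOnFinite.symm (Fin.snoc (α := fun _ => ℕ) b c)

@[simp] theorem projHat_embed {n : ℕ} (c : ℕ) (b : Fin n →₀ ℕ) : projHat (embed c b) = b := by
  ext i; simp [projHat, embed]

@[simp] theorem embed_last {n : ℕ} (c : ℕ) (b : Fin n →₀ ℕ) : embed c b (Fin.last n) = c := by
  simp [embed]

theorem embed_projHat {n : ℕ} (d : Fin (n + 1) →₀ ℕ) : embed (d (Fin.last n)) (projHat d) = d := by
  ext i
  refine Fin.lastCases ?_ (fun j => ?_) i <;> simp [projHat, embed]

/-- The limiting set `E(D)`: the exponents outside `D` all of whose lower neighbours are in `D`. -/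
def limitingSet {n : ℕ} (D : Set (Fin n →₀ ℕ)) : Set (Fin n →₀ ℕ) :=
  {b | b ∉ D ∧ ∀ i, b i ≠ 0 → b - Finsupp.single i 1 ∈ D}

/-! ### Points with multiplicity structures and their vanishing ideal -/

/-- The iterated partial derivative of `f` of multi-order `d`. -/
def partialDeriv {k : Type*} [CommSemiring k] {n : ℕ} (d : Fin n →₀ ℕ)
    (f : MvPolynomial (Fin n) k) : MvPolynomial (Fin n) k :=
  (List.finRange n).foldr (fun i g => (pderiv i)^[d i] g) f

/-- The functional of a point `p` and an exponent `d`: differentiate `d` times, evaluate at `p`. -/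
def derivFunctional {k : Type*} [CommSemiring k] {n : ℕ} (p : Fin n → k) (d : Fin n →₀ ℕ)
    (f : MvPolynomial (Fin n) k) : k :=
  eval p (partialDeriv d f)

/-- A finite set of (distinct) points of `k ^ n`, each with a finite lower set of exponents as its
multiplicity structure. The values of `mult` outside `pts` play no role. -/
structure PointsWithMult (k : Type*) (n : ℕ) where
  pts : Finset (Fin n → k)
  mult : (Fin n → k) → Finset (Fin n →₀ ℕ)
  lower : ∀ p ∈ pts, IsLowerSet (mult p : Set (Fin n →₀ ℕ))

/-- The number `m` of functionals. -/
def PointsWithMult.numFunctionals {k : Type*} {n : ℕ} (H : PointsWithMult k n) : ℕ :=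
  ∑ p ∈ H.pts, (H.mult p).card

section Ideal

variable {k : Type*} [CommSemiring k] {n : ℕ}

theorem iterate_pderiv_X_mul_of_ne {i j : Fin n} (h : j ≠ i) (m : ℕ) (g : MvPolynomial (Fin n) k) :
    (pderiv i)^[m] (X j * g) = X j * (pderiv i)^[m] g := by
  induction m with
  | zero => rfl
  | succ m ih =>
    rw [Function.iterate_succ_apply', ih, Function.iterate_succ_apply', pderiv_mul,
      pderiv_X_of_ne h]
    simp

theorem iterate_pderiv_X_mul_self (i : Fin n) (m : ℕ) (g : MvPolynomial (Fin n) k) :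
    (pderiv i)^[m] (X i * g) = X i * (pderiv i)^[m] g + m • (pderiv i)^[m - 1] g := by
  induction m with
  | zero => simp
  | succ m ih =>
    rw [Function.iterate_succ_apply', ih, Function.iterate_succ_apply', map_add, pderiv_mul,
      pderiv_X_self, map_nsmul]
    rcases m with _ | m
    · simp
      ring
    · rw [Nat.add_sub_cancel, Nat.add_sub_cancel, ← Function.iterate_succ_apply' (pderiv i) m g,
        Nat.succ_eq_add_one, succ_nsmul _ (m + 1)]
      ring

theorem foldr_pderiv_add (l : List (Fin n)) (d : Fin n →₀ ℕ) (f g : MvPolynomial (Fin n) k) :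
    l.foldr (fun i g => (pderiv i)^[d i] g) (f + g)
      = l.foldr (fun i g => (pderiv i)^[d i] g) f + l.foldr (fun i g => (pderiv i)^[d i] g) g := by
  induction l with
  | nil => rfl
  | cons i l ih => simp [ih, iterate_map_add]

theorem foldr_pderiv_smul (l : List (Fin n)) (d : Fin n →₀ ℕ) (c : k)
    (f : MvPolynomial (Fin n) k) :
    l.foldr (fun i g => (pderiv i)^[d i] g) (C c * f)
      = C c * l.foldr (fun i g => (pderiv i)^[d i] g) f := by
  induction l with
  | nil => rfl
  | cons i l ih =>
    rw [List.foldr_cons, ih, List.foldr_cons]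
    generalize l.foldr (fun i g => (pderiv i)^[d i] g) f = h
    induction d i with
    | zero => rfl
    | succ m ihm => rw [Function.iterate_succ_apply', ihm, Function.iterate_succ_apply',
        pderiv_C_mul]

theorem foldr_pderiv_X_mul (l : List (Fin n)) (hl : l.Nodup) (d : Fin n →₀ ℕ) (j : Fin n)
    (f : MvPolynomial (Fin n) k) :
    (j ∉ l → l.foldr (fun i g => (pderiv i)^[d i] g) (X j * f)
      = X j * l.foldr (fun i g => (pderiv i)^[d i] g) f) ∧
    (j ∈ l → l.foldr (fun i g => (pderiv i)^[d i] g) (X j * f)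
      = X j * l.foldr (fun i g => (pderiv i)^[d i] g) f +
        d j • l.foldr (fun i g => (pderiv i)^[(d - Finsupp.single j 1 : Fin n →₀ ℕ) i] g) f) := by
  induction l with
  | nil => simp
  | cons i l ih =>
    obtain ⟨hi, hl⟩ := List.nodup_cons.1 hl
    obtain ⟨ih1, ih2⟩ := ih hl
    refine ⟨fun hj => ?_, fun hj => ?_⟩
    · simp only [List.mem_cons, not_or] at hj
      simp only [List.foldr_cons]
      rw [ih1 hj.2, iterate_pderiv_X_mul_of_ne hj.1]
    · by_cases hij : j = i
      · subst hij
        simp only [List.foldr_cons]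
        rw [ih1 hi, iterate_pderiv_X_mul_self]
        have : l.foldr (fun i g => (pderiv i)^[(d - Finsupp.single j 1 : Fin n →₀ ℕ) i] g) f
            = l.foldr (fun i g => (pderiv i)^[d i] g) f := by
          apply List.foldr_ext
          intro a ha b
          have : j ≠ a := fun h => hi (h ▸ ha)
          simp [this]
        rw [this]
        simp
      · have hjl : j ∈ l := by simpa [hij] using hj
        simp only [List.foldr_cons]
        rw [ih2 hjl, iterate_map_add, iterate_pderiv_X_mul_of_ne hij, iterate_map_nsmul]
        simp [Finsupp.single_apply, hij]

theorem derivFunctional_X_mul (p : Fin n → k) (d : Fin n →₀ ℕ) (j : Fin n)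
    (f : MvPolynomial (Fin n) k) :
    derivFunctional p d (X j * f)
      = p j * derivFunctional p d f + d j • derivFunctional p (d - Finsupp.single j 1) f := by
  unfold derivFunctional partialDeriv
  rw [(foldr_pderiv_X_mul _ (List.nodup_finRange n) d j f).2 (List.mem_finRange j)]
  simp

end Ideal

/-- The vanishing ideal `I(H)`: the polynomials killed by all functionals of `H`. -/
def PointsWithMult.vanishingIdeal {k : Type*} [CommSemiring k] {n : ℕ} (H : PointsWithMult k n) :
    Ideal (MvPolynomial (Fin n) k) where
  carrier := {f | ∀ p ∈ H.pts, ∀ d ∈ H.mult p, derivFunctional p d f = 0}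
  zero_mem' := fun p _ d _ => by
    have := foldr_pderiv_smul (List.finRange n) d (0 : k) 0
    simp only [map_zero, zero_mul] at this
    simp [derivFunctional, partialDeriv, this]
  add_mem' := fun {f g} hf hg p hp d hd => by
    have h1 := hf p hp d hd
    have h2 := hg p hp d hd
    unfold derivFunctional partialDeriv at *
    rw [foldr_pderiv_add, map_add, h1, h2, add_zero]
  smul_mem' := fun g f hf => by
    rw [smul_eq_mul]
    induction g using MvPolynomial.induction_on generalizing f with
    | C c =>
      intro p hp d hd
      have h1 := hf p hp d hd
      unfold derivFunctional partialDeriv at *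
      rw [foldr_pderiv_smul, map_mul, h1, mul_zero]
    | add a b ha hb =>
      intro p hp d hd
      have h1 := ha f hf p hp d hd
      have h2 := hb f hf p hp d hd
      unfold derivFunctional partialDeriv at *
      rw [add_mul, foldr_pderiv_add, map_add, h1, h2, add_zero]
    | mul_X a j ha =>
      rw [mul_assoc]
      refine ha _ fun p hp d hd => ?_
      rw [derivFunctional_X_mul, hf p hp d hd,
        hf p hp _ (H.lower p hp (tsub_le_self (a := d) (b := Finsupp.single j 1)) hd)]
      simp

/-! ### Matrix form

The rows `(p, d)` of the matrix form of a set of points with multiplicity structures: one row for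
each point `p` and each exponent `d` in the multiplicity structure of `p`. -/

/-- A row of the matrix form. -/
abbrev Row (k : Type*) (n : ℕ) := (Fin n → k) × (Fin n →₀ ℕ)

open scoped Classical in
/-- All the rows of the matrix form of `H`. -/
def PointsWithMult.rows {k : Type*} {n : ℕ} (H : PointsWithMult k n) : Finset (Row k n) :=
  H.pts.biUnion fun p => (H.mult p).image fun d => (p, d)

open scoped Classical in
/-- The values taken by the last coordinates of the points. -/
def lastValues {k : Type*} {n : ℕ} (R : Finset (Row k (n + 1))) : Finset k :=
  R.image fun r => r.1 (Fin.last n)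

open scoped Classical in
/-- The rows whose point has last coordinate `c`. -/
def fibre {k : Type*} {n : ℕ} (R : Finset (Row k (n + 1))) (c : k) : Finset (Row k (n + 1)) :=
  R.filter fun r => r.1 (Fin.last n) = c

/-- The largest last coordinate `w` of the exponents. -/
def maxLast {k : Type*} {n : ℕ} (R : Finset (Row k (n + 1))) : ℕ :=
  R.sup fun r => r.2 (Fin.last n)

open scoped Classical in
/-- The rows whose exponent has last coordinate `i`, with the last columns of both matrices
eliminated. -/
def slice {k : Type*} {n : ℕ} (R : Finset (Row k (n + 1))) (i : ℕ) : Finset (Row k n) :=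
  (R.filter fun r => r.2 (Fin.last n) = i).image fun r => (fun j => r.1 j.castSucc, projHat r.2)

/-! ### Addition of lower sets -/

/-- The number of elements of `D` on the line over `b` in the direction of the last axis. -/
def columnCount {n : ℕ} (D : Finset (Fin (n + 1) →₀ ℕ)) (b : Fin n →₀ ℕ) : ℕ :=
  (D.filter fun d => projHat d = b).card

/-- The addition `D₁ + D₂` of lower sets: along the last axis, the elements of `D₂` are dropped on
top of those of `D₁`, so that the columns of `D₁` and `D₂` are put on each other. -/
def addLower {n : ℕ} (D₁ D₂ : Finset (Fin (n + 1) →₀ ℕ)) : Finset (Fin (n + 1) →₀ ℕ) :=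
  ((D₁ ∪ D₂).image projHat).biUnion fun b =>
    (Finset.range (columnCount D₁ b + columnCount D₂ b)).image fun j => embed j b

theorem mem_addLower {n : ℕ} (D₁ D₂ : Finset (Fin (n + 1) →₀ ℕ)) (a : Fin (n + 1) →₀ ℕ) :
    a ∈ addLower D₁ D₂ ↔
      a (Fin.last n) < columnCount D₁ (projHat a) + columnCount D₂ (projHat a) := by
  simp only [addLower, Finset.mem_biUnion, Finset.mem_image, Finset.mem_range]
  constructor
  · rintro ⟨b, -, j, hj, rfl⟩
    simpa using hj
  · intro h
    refine ⟨projHat a, ?_, _, h, embed_projHat a⟩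
    by_contra hc
    have h1 : columnCount D₁ (projHat a) = 0 := by
      rw [columnCount, Finset.card_eq_zero, Finset.filter_eq_empty_iff]
      exact fun d hd he => hc ⟨d, Finset.mem_union_left _ hd, he⟩
    have h2 : columnCount D₂ (projHat a) = 0 := by
      rw [columnCount, Finset.card_eq_zero, Finset.filter_eq_empty_iff]
      exact fun d hd he => hc ⟨d, Finset.mem_union_right _ hd, he⟩
    omega

theorem columnCount_addLower {n : ℕ} (D₁ D₂ : Finset (Fin (n + 1) →₀ ℕ)) (b : Fin n →₀ ℕ) :
    columnCount (addLower D₁ D₂) b = columnCount D₁ b + columnCount D₂ b := by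
  have : (addLower D₁ D₂).filter (fun d => projHat d = b)
      = (Finset.range (columnCount D₁ b + columnCount D₂ b)).image fun j => embed j b := by
    ext a
    simp only [Finset.mem_filter, mem_addLower, Finset.mem_image, Finset.mem_range]
    constructor
    · rintro ⟨h, rfl⟩
      exact ⟨_, h, embed_projHat a⟩
    · rintro ⟨j, hj, rfl⟩
      simpa using hj
  rw [columnCount, this, Finset.card_image_of_injective, Finset.card_range]
  intro i j h
  simpa using DFunLike.congr_fun h (Fin.last n)

instance addLower_commutative {n : ℕ} : Std.Commutative (addLower (n := n)) :=
  ⟨fun D₁ D₂ => by ext a; simp only [mem_addLower]; omega⟩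

instance addLower_associative {n : ℕ} : Std.Associative (addLower (n := n)) :=
  ⟨fun D₁ D₂ D₃ => by ext a; simp only [mem_addLower, columnCount_addLower]; omega⟩

/-! ### The lower set `D(H)` -/

/-- The special case (all points have the same last coordinate) of the construction of the lower
set in dimension `n + 1`, from the construction `rec` in dimension `n`. -/
def lowerSetSpecial {k : Type*} {n : ℕ} (rec : Finset (Row k n) → Finset (Fin n →₀ ℕ))
    (R : Finset (Row k (n + 1))) : Finset (Fin (n + 1) →₀ ℕ) :=
  (Finset.range (maxLast R + 1)).biUnion fun i => (rec (slice R i)).image (embed i)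

/-- The lower set associated with a set of points with multiplicity structures in dimension
`n + 1`, given in matrix form, by induction over the dimension. -/
def lowerSetOf {k : Type*} : (n : ℕ) → Finset (Row k (n + 1)) → Finset (Fin (n + 1) →₀ ℕ)
  | 0, R => (Finset.range R.card).image fun j => Finsupp.single 0 j
  | n + 1, R =>
    (lastValues R).fold addLower ∅ fun c => lowerSetSpecial (lowerSetOf n) (fibre R c)

/-- The lower set `D(H)`. -/
def PointsWithMult.lowerSet {k : Type*} {n : ℕ} (H : PointsWithMult k (n + 1)) :
    Finset (Fin (n + 1) →₀ ℕ) :=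
  lowerSetOf n H.rows

/-! ### The polynomial set `poly(H)`

The algorithm leaves some choices open (the order in which the fibres are treated, the divisor
selected in GLP, the Bézout cofactors, the way in which a polynomial is reduced). It is therefore
described by a relation between input and output, which holds for the outcomes of all choices.
The monomial order is lexicographic with `X 0 ≻ X 1 ≻ ⋯`. -/

/-- `r` is a remainder of the division of `f` by the polynomials in `B`: one has
`f = ∑ g b * b + r`, where no `g b * b` has a larger leading monomial than `f`, and no term of `r`
is divisible by a leading monomial of an element of `B`. -/
def IsRemainder {n : ℕ} {k : Type*} [CommRing k] (m : MonomialOrder (Fin n))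
    (f : MvPolynomial (Fin n) k) (B : Set (MvPolynomial (Fin n) k)) (r : MvPolynomial (Fin n) k) :
    Prop :=
  (∃ g : B →₀ MvPolynomial (Fin n) k,
    f = Finsupp.linearCombination _ (fun b : B => (b : MvPolynomial (Fin n) k)) g + r ∧
    ∀ b : B, m.degree ((b : MvPolynomial (Fin n) k) * g b) ≼[m] m.degree f) ∧
  ∀ c ∈ r.support, ∀ b ∈ B, ¬ m.degree b ≤ c

/-- The last coordinate of `GLT(a, D)`: the least `j` such that replacing the last coordinate of
`a` by `j` gives an exponent outside `D`. -/
def gltLast {n : ℕ} (a : Fin (n + 1) →₀ ℕ) (D : Finset (Fin (n + 1) →₀ ℕ)) : ℕ :=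
  sInf {j | embed j (projHat a) ∉ D}

/-- The exponent `GLT(a, D)`. -/
def glt {n : ℕ} (a : Fin (n + 1) →₀ ℕ) (D : Finset (Fin (n + 1) →₀ ℕ)) : Fin (n + 1) →₀ ℕ :=
  embed (gltLast a D) (projHat a)

/-- `p` is a possible output of `GLP(a, D, G)`: a monomial multiple, with leading monomial
`GLT(a, D)`, of an element of `G` whose leading monomial is in `E(D)`. -/
def IsGLP {k : Type*} [Field k] {n : ℕ} (a : Fin (n + 1) →₀ ℕ) (D : Finset (Fin (n + 1) →₀ ℕ))
    (G : Set (MvPolynomial (Fin (n + 1)) k)) (p : MvPolynomial (Fin (n + 1)) k) : Prop :=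
  ∃ c' ∈ limitingSet (D : Set (Fin (n + 1) →₀ ℕ)), c' ≤ glt a D ∧
    ∃ f ∈ G, MonomialOrder.lex.degree f = c' ∧ p = f * monomial (glt a D - c') 1

/-- The special case of the construction of the polynomials in dimension `n + 1` (all points have
the last coordinate `c`), from the construction `recD`, `recP` in dimension `n`. -/
def IsPolySpecial {k : Type*} [Field k] {n : ℕ} (recD : Finset (Row k n) → Finset (Fin n →₀ ℕ))
    (recP : Finset (Row k n) → Set (MvPolynomial (Fin n) k) → Prop)
    (R : Finset (Row k (n + 1))) (c : k) (G : Set (MvPolynomial (Fin (n + 1)) k)) : Prop :=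
  ∃ Gt : ℕ → Set (MvPolynomial (Fin n) k),
    (∀ i ≤ maxLast R, recP (slice R i) (Gt i)) ∧
    G = {g | (g = (X (Fin.last n) - C c) ^ (maxLast R + 1) ∨
        ∃ i ≤ maxLast R, ∃ f ∈ Gt i,
          g = rename Fin.castSucc f * (X (Fin.last n) - C c) ^ i) ∧
      MonomialOrder.lex.degree g ∈
        limitingSet (lowerSetSpecial recD R : Set (Fin (n + 1) →₀ ℕ))}

/-- `f` is a polynomial built for the leading monomial `a` from the polynomials `G`, with lower set
`D`, of the fibres over `done`, and the polynomials `Gc`, with lower set `Dc c`, of the fibre over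
`c`. Here `Dc b` and `w b` are the lower set and the largest last exponent of the fibre over `b`. -/
def IsCandidate {k : Type*} [Field k] {n : ℕ} (Dc : k → Finset (Fin (n + 1) →₀ ℕ)) (w : k → ℕ)
    (done : List k) (D : Finset (Fin (n + 1) →₀ ℕ)) (G : Set (MvPolynomial (Fin (n + 1)) k))
    (c : k) (Gc : Set (MvPolynomial (Fin (n + 1)) k)) (a : Fin (n + 1) →₀ ℕ)
    (f : MvPolynomial (Fin (n + 1)) k) : Prop :=
  ∃ f₁ f₂ : MvPolynomial (Fin (n + 1)) k, ∃ r₁ r₂ : Polynomial k,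
    IsGLP a D G f₁ ∧ IsGLP a (Dc c) Gc f₂ ∧
    r₁ * (Polynomial.X - Polynomial.C c) ^ (w c + 1 - gltLast a (Dc c)) +
      r₂ * (done.map fun b =>
        (Polynomial.X - Polynomial.C b) ^ (w b + 1 - gltLast a (Dc b))).prod = 1 ∧
    f = Polynomial.aeval (X (Fin.last n)) r₁ *
          (f₁ * (X (Fin.last n) - C c) ^ (w c + 1)) +
        Polynomial.aeval (X (Fin.last n)) r₂ *
          (f₂ * (done.map fun b => (X (Fin.last n) - C b) ^ (w b + 1)).prod)

/-- The inner loop: for each exponent `a` of the list in turn, a polynomial `f` with `cand a f` is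
reduced by the polynomials found so far, and the result is added to these. -/
def InnerLoop {k : Type*} [Field k] {n : ℕ}
    (cand : (Fin n →₀ ℕ) → MvPolynomial (Fin n) k → Prop) :
    Set (MvPolynomial (Fin n) k) → List (Fin n →₀ ℕ) → Set (MvPolynomial (Fin n) k) → Prop
  | Gh, [], G' => G' = Gh
  | Gh, a :: L, G' => ∃ f f', cand a f ∧ IsRemainder MonomialOrder.lex f Gh f' ∧
      InnerLoop cand (insert f' Gh) L G'

/-- The outer loop: the fibres over the remaining values are merged one after the other with the
result `D`, `G` for the fibres over `done`. The limiting set of the new lower set is run through in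
increasing lexicographic order. -/
def OuterLoop {k : Type*} [Field k] {n : ℕ} (Dc : k → Finset (Fin (n + 1) →₀ ℕ)) (w : k → ℕ)
    (Gc : k → Set (MvPolynomial (Fin (n + 1)) k)) :
    List k → Finset (Fin (n + 1) →₀ ℕ) → Set (MvPolynomial (Fin (n + 1)) k) → List k →
      Set (MvPolynomial (Fin (n + 1)) k) → Prop
  | _, _, G, [], G' => G' = G
  | done, D, G, c :: rest, G' => ∃ L : List (Fin (n + 1) →₀ ℕ), ∃ Gh,
      L.Pairwise (fun a b => a ≺[MonomialOrder.lex] b) ∧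
      (∀ a, a ∈ L ↔ a ∈ limitingSet (addLower D (Dc c) : Set (Fin (n + 1) →₀ ℕ))) ∧
      InnerLoop (IsCandidate Dc w done D G c (Gc c)) ∅ L Gh ∧
      OuterLoop Dc w Gc (done ++ [c]) (addLower D (Dc c)) Gh rest G'

/-- The general case: split into fibres, treat the first one, merge the others one by one. (There is
no fibre only if there are no functionals at all; the result is then `{1}`, as in dimension 1.) -/
def IsPolyGeneral {k : Type*} [Field k] {n : ℕ} (Dc : k → Finset (Fin (n + 1) →₀ ℕ)) (w : k → ℕ)
    (Gc : k → Set (MvPolynomial (Fin (n + 1)) k)) :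
    List k → Set (MvPolynomial (Fin (n + 1)) k) → Prop
  | [], G => G = {1}
  | c :: rest, G => OuterLoop Dc w Gc [c] (Dc c) (Gc c) rest G

open scoped Classical in
/-- `G` is a possible output of the algorithm for the polynomial set associated with a set of points
with multiplicity structures in dimension `n + 1`, given in matrix form, by induction over the
dimension. -/
def IsPolyOf {k : Type*} [Field k] :
    (n : ℕ) → Finset (Row k (n + 1)) → Set (MvPolynomial (Fin (n + 1)) k) → Prop
  | 0, R, G => G = {∏ p ∈ R.image Prod.fst, (X 0 - C (p 0)) ^ (R.filter fun r => r.1 = p).card}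
  | n + 1, R, G => ∃ cs : List k, cs.Nodup ∧ (∀ c, c ∈ cs ↔ c ∈ lastValues R) ∧
      ∃ Gc : k → Set (MvPolynomial (Fin (n + 2)) k),
        (∀ c ∈ cs, IsPolySpecial (lowerSetOf n) (IsPolyOf n) (fibre R c) c (Gc c)) ∧
        IsPolyGeneral (fun c => lowerSetSpecial (lowerSetOf n) (fibre R c))
          (fun c => maxLast (fibre R c)) Gc cs G

/-- `G` is a possible value of `poly(H)`. -/
def PointsWithMult.IsPoly {k : Type*} [Field k] {n : ℕ} (H : PointsWithMult k (n + 1))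
    (G : Set (MvPolynomial (Fin (n + 1)) k)) : Prop :=
  IsPolyOf n H.rows G

/-! ### Reduced Gröbner bases and quotient bases -/

/-- `G` is the reduced Gröbner basis of the ideal `I` for the monomial order `m`. -/
structure IsReducedGroebnerBasis {n : ℕ} {k : Type*} [Field k] (m : MonomialOrder (Fin n))
    (G : Set (MvPolynomial (Fin n) k)) (I : Ideal (MvPolynomial (Fin n) k)) : Prop where
  finite : G.Finite
  span_eq : Ideal.span G = I
  /-- Every leading monomial of the ideal is divisible by the leading monomial of an element of
  `G`. -/
  exists_degree_le : ∀ f ∈ I, f ≠ 0 → ∃ g ∈ G, m.degree g ≤ m.degree f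
  monic : ∀ g ∈ G, m.Monic g
  /-- No term of an element of `G` is divisible by the leading monomial of another one. -/
  reduced : ∀ g ∈ G, ∀ g' ∈ G, g' ≠ g → ∀ c ∈ g.support, ¬ m.degree g' ≤ c

/-- `D` is the quotient basis of `I` for the monomial order `m`: it consists of the monomials that
are not leading monomials of elements of `I`, and their classes form a basis of the quotient. -/
structure IsQuotientBasis {n : ℕ} {k : Type*} [Field k] (m : MonomialOrder (Fin n))
    (D : Finset (Fin n →₀ ℕ)) (I : Ideal (MvPolynomial (Fin n) k)) : Prop where
  mem_iff : ∀ a, a ∈ D ↔ ¬ ∃ f ∈ I, f ≠ 0 ∧ m.degree f = a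
  linearIndependent : LinearIndependent k
    fun d : D => Ideal.Quotient.mk I (monomial (d : Fin n →₀ ℕ) (1 : k))
  span_eq_top : Submodule.span k
    (Set.range fun d : D => Ideal.Quotient.mk I (monomial (d : Fin n →₀ ℕ) (1 : k))) = ⊤

end

/-! Read a polynomial in `n + 1` variables as a polynomial in the first `n` variables with
coefficients in k[X_last]. The lexicographic order compares the first `n` exponents first, so the
leading exponent of f is (b, e), where b is the largest monomial occurring and e is the degree of
its coefficient. For an ideal I and fixed b, the coefficients at b of those elements of I with
nothing above b form an ideal of k[X_last], which is principal, say generated by V_b. If all V_b are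
monic, the exponents that do not lead in I are exactly the (b, j) with j < deg V_b. `LeadControl`
records the V_b; `LeadControl.isNonLeading` reads off the lower set.

For one fibre X_last = c, expand in powers of X_last - c. A functional (p, d) sees only the Taylor
coefficient of index d_last, up to the factor d_last!, which the hypothesis on the characteristic
makes invertible. Hence f lies in the ideal iff each Taylor coefficient lies in the ideal of the
corresponding slice (`mem_rowIdeal_iff_hatTaylor`), and by induction V_b is (X_last - c)^h with h
the height of the column over b (`leadControl_rowIdeal`). The ideals of distinct fibres contain
coprime polynomials in X_last alone; by Bézout, V_b of the intersection is the product of the V_b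
(`LeadControl.inf`). Degrees add under products, which is why columns are stacked.

For the polynomials, a monic element whose leading exponent is as low as possible over b has all of
V_b as its coefficient (`LeadControl.hatCoeff_eq`), so the algorithm's Bézout combination has
exactly the required coefficient (`IsMergeState.candidate`). Dividing by the polynomials of the
smaller corners moves all other exponents into D (`IsReducedSet.insert_remainder`). One monic
element of I per corner, with tail in D, makes a reduced Gröbner basis
(`IsReducedSet.isReducedGroebnerBasis`). These statements hold for every outcome of every choice.
The lower set in one variable is obtained from the same construction over zero variables. -/

/-! ### Coefficients in the last variable, lexicographic order, Taylor expansion. -/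

section HatCoeff

variable {k : Type*} [Field k] {n : ℕ}

/-- A polynomial in `n + 1` variables as a polynomial in the first `n` variables, with coefficients
polynomials in the last one. -/
noncomputable def hatPoly :
    MvPolynomial (Fin (n + 1)) k →ₐ[k] MvPolynomial (Fin n) (Polynomial k) :=
  aeval (Fin.lastCases (motive := fun _ => MvPolynomial (Fin n) (Polynomial k))
    (C Polynomial.X) X)

/-- The coefficient of the monomial `b` in the first `n` variables, a polynomial in the last one. -/
noncomputable def hatCoeff (b : Fin n →₀ ℕ) (f : MvPolynomial (Fin (n + 1)) k) : Polynomial k :=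
  coeff b (hatPoly f)

@[simp] theorem projHat_apply (d : Fin (n + 1) →₀ ℕ) (i : Fin n) : projHat d i = d i.castSucc :=
  rfl

@[simp] theorem embed_castSucc (j : ℕ) (b : Fin n →₀ ℕ) (i : Fin n) :
    embed j b i.castSucc = b i := by
  simp [embed]

theorem hatPoly_monomial (e : Fin (n + 1) →₀ ℕ) (a : k) :
    hatPoly (monomial e a) = monomial (projHat e) (Polynomial.monomial (e (Fin.last n)) a) := by
  rw [hatPoly, aeval_monomial, Finsupp.prod_fintype _ _ (by simp), Fin.prod_univ_castSucc,
    monomial_eq, Finsupp.prod_fintype _ _ (by simp)]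
  simp only [Fin.lastCases_castSucc, Fin.lastCases_last, projHat_apply]
  rw [← Polynomial.C_mul_X_pow_eq_monomial, map_mul, map_pow]
  have : (algebraMap k (MvPolynomial (Fin n) (Polynomial k))) a = C (Polynomial.C a) := rfl
  rw [this]
  ring

theorem coeff_hatCoeff (b : Fin n →₀ ℕ) (j : ℕ) (f : MvPolynomial (Fin (n + 1)) k) :
    (hatCoeff b f).coeff j = coeff (embed j b) f := by
  classical
  induction f using MvPolynomial.induction_on' with
  | monomial e a =>
    rw [hatCoeff, hatPoly_monomial, coeff_monomial, coeff_monomial]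
    by_cases h : projHat e = b
    · subst h
      rw [if_pos rfl, Polynomial.coeff_monomial]
      refine if_congr ⟨fun h => ?_, fun h => ?_⟩ rfl rfl
      · rw [← h, embed_projHat]
      · rw [h, embed_last]
    · rw [if_neg h, Polynomial.coeff_zero, if_neg]
      rintro rfl
      exact h (projHat_embed _ _)
  | add p q hp hq =>
    rw [hatCoeff] at *
    rw [map_add, coeff_add, Polynomial.coeff_add, hp, hq, coeff_add]

theorem hatPoly_injective : Function.Injective (hatPoly (k := k) (n := n)) := by
  intro f g h
  ext e
  rw [← embed_projHat e, ← coeff_hatCoeff, ← coeff_hatCoeff, hatCoeff, hatCoeff, h]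

theorem hatCoeff_add (b : Fin n →₀ ℕ) (f g : MvPolynomial (Fin (n + 1)) k) :
    hatCoeff b (f + g) = hatCoeff b f + hatCoeff b g := by
  simp [hatCoeff]

theorem hatPoly_aeval_last (q : Polynomial k) :
    hatPoly (Polynomial.aeval (X (Fin.last n)) q) = C q := by
  have h : hatPoly (X (Fin.last n)) = (C Polynomial.X : MvPolynomial (Fin n) (Polynomial k)) := by
    simp [hatPoly]
  rw [← Polynomial.aeval_algHom_apply, h]
  induction q using Polynomial.induction_on' with
  | add p q hp hq => rw [map_add, hp, hq, map_add]
  | monomial m a =>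
    rw [Polynomial.aeval_monomial, ← Polynomial.C_mul_X_pow_eq_monomial, map_mul, map_pow]
    rfl

theorem hatPoly_rename (g : MvPolynomial (Fin n) k) :
    hatPoly (rename Fin.castSucc g) = map Polynomial.C g := by
  rw [hatPoly, aeval_rename]
  induction g using MvPolynomial.induction_on with
  | C a => simp only [algHom_C, map_C]; rfl
  | add p q hp hq => rw [map_add, hp, hq, map_add]
  | mul_X p i hp => rw [map_mul, hp, map_mul]; simp

theorem hatCoeff_aeval_mul (b : Fin n →₀ ℕ) (q : Polynomial k)
    (f : MvPolynomial (Fin (n + 1)) k) :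
    hatCoeff b (Polynomial.aeval (X (Fin.last n)) q * f) = q * hatCoeff b f := by
  rw [hatCoeff, map_mul, hatPoly_aeval_last, coeff_C_mul, hatCoeff]

theorem hatCoeff_mul_aeval (b : Fin n →₀ ℕ) (q : Polynomial k)
    (f : MvPolynomial (Fin (n + 1)) k) :
    hatCoeff b (f * Polynomial.aeval (X (Fin.last n)) q) = hatCoeff b f * q := by
  rw [mul_comm, hatCoeff_aeval_mul, mul_comm]

theorem hatCoeff_rename (b : Fin n →₀ ℕ) (g : MvPolynomial (Fin n) k) :
    hatCoeff b (rename Fin.castSucc g) = Polynomial.C (coeff b g) := by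
  rw [hatCoeff, hatPoly_rename, coeff_map]

theorem eq_sum_hatCoeff (f : MvPolynomial (Fin (n + 1)) k) :
    f = ∑ b ∈ (hatPoly f).support, rename Fin.castSucc (monomial b (1 : k)) *
      Polynomial.aeval (X (Fin.last n)) (hatCoeff b f) := by
  apply hatPoly_injective
  rw [map_sum]
  conv_lhs => rw [(hatPoly f).as_sum]
  refine Finset.sum_congr rfl fun b _ => ?_
  rw [map_mul, hatPoly_aeval_last, hatPoly_rename, map_monomial, mul_comm, C_mul_monomial]
  simp [hatCoeff]

/-! ### The lexicographic order -/

/-- The order being lexicographic enters only through this equivalence. -/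
theorem lex_lt_iff_projHat (a a' : Fin (n + 1) →₀ ℕ) :
    a ≺[MonomialOrder.lex] a' ↔ projHat a ≺[MonomialOrder.lex] projHat a' ∨
      projHat a = projHat a' ∧ a (Fin.last n) < a' (Fin.last n) := by
  simp only [MonomialOrder.lex_lt_iff, Finsupp.Lex.lt_iff, ofLex_toLex]
  constructor
  · rintro ⟨i, h1, h2⟩
    induction i using Fin.lastCases with
    | last => exact Or.inr ⟨by ext j; exact h1 _ (Fin.castSucc_lt_last j), h2⟩
    | cast i => exact Or.inl ⟨i, fun j hj => h1 _ (Fin.castSucc_lt_castSucc_iff.2 hj), h2⟩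
  · rintro (⟨i, h1, h2⟩ | ⟨h1, h2⟩)
    · refine ⟨i.castSucc, fun j hj => ?_, h2⟩
      induction j using Fin.lastCases with
      | last => exact absurd hj (Fin.castSucc_lt_last i).asymm
      | cast j => exact h1 _ (Fin.castSucc_lt_castSucc_iff.1 hj)
    · refine ⟨Fin.last n, fun j hj => ?_, h2⟩
      induction j using Fin.lastCases with
      | last => exact absurd hj (lt_irrefl _)
      | cast j => exact DFunLike.congr_fun h1 j

/-- No monomial in the first `n` variables that occurs in `f` is larger than `b`. -/
def HatLE (b : Fin n →₀ ℕ) (f : MvPolynomial (Fin (n + 1)) k) : Prop :=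
  ∀ b', b ≺[MonomialOrder.lex] b' → hatCoeff b' f = 0

theorem HatLE.add {b : Fin n →₀ ℕ} {f g : MvPolynomial (Fin (n + 1)) k} (hf : HatLE b f)
    (hg : HatLE b g) : HatLE b (f + g) := fun b' h => by
  rw [hatCoeff_add, hf b' h, hg b' h, add_zero]

theorem HatLE.aeval_mul {b : Fin n →₀ ℕ} {f : MvPolynomial (Fin (n + 1)) k} (hf : HatLE b f)
    (q : Polynomial k) : HatLE b (Polynomial.aeval (X (Fin.last n)) q * f) := fun b' h => by
  rw [hatCoeff_aeval_mul, hf b' h, mul_zero]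

theorem HatLE.mul_aeval {b : Fin n →₀ ℕ} {f : MvPolynomial (Fin (n + 1)) k} (hf : HatLE b f)
    (q : Polynomial k) : HatLE b (f * Polynomial.aeval (X (Fin.last n)) q) := by
  rw [mul_comm]; exact hf.aeval_mul q

theorem hatLE_rename {g : MvPolynomial (Fin n) k} :
    HatLE (MonomialOrder.lex.degree g) (rename Fin.castSucc g) := fun b' h => by
  rw [hatCoeff_rename, MonomialOrder.coeff_eq_zero_of_lt h, map_zero]

theorem hatLE_degree (f : MvPolynomial (Fin (n + 1)) k) :
    HatLE (projHat (MonomialOrder.lex.degree f)) f := fun b' h => by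
  ext j
  rw [coeff_hatCoeff, MonomialOrder.coeff_eq_zero_of_lt (m := MonomialOrder.lex),
    Polynomial.coeff_zero]
  rw [lex_lt_iff_projHat, projHat_embed]
  exact Or.inl h

theorem natDegree_hatCoeff_degree {f : MvPolynomial (Fin (n + 1)) k} (hf : f ≠ 0) :
    (hatCoeff (projHat (MonomialOrder.lex.degree f)) f).natDegree
      = MonomialOrder.lex.degree f (Fin.last n) := by
  apply le_antisymm
  · refine Polynomial.natDegree_le_iff_coeff_eq_zero.2 fun j hj => ?_
    rw [coeff_hatCoeff, MonomialOrder.coeff_eq_zero_of_lt (m := MonomialOrder.lex)]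
    rw [lex_lt_iff_projHat, projHat_embed, embed_last]
    exact Or.inr ⟨rfl, hj⟩
  · apply Polynomial.le_natDegree_of_ne_zero
    rw [coeff_hatCoeff, embed_projHat]
    exact MonomialOrder.coeff_degree_ne_zero_iff.2 hf

theorem leadingCoeff_hatCoeff_degree {f : MvPolynomial (Fin (n + 1)) k} (hf : f ≠ 0) :
    (hatCoeff (projHat (MonomialOrder.lex.degree f)) f).leadingCoeff
      = MonomialOrder.lex.leadingCoeff f := by
  rw [Polynomial.leadingCoeff, natDegree_hatCoeff_degree hf, coeff_hatCoeff, embed_projHat]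
  rfl

/-- Leading monomials are computed below through this: a bound on the first `n` exponents and one
univariate coefficient suffice. -/
theorem HatLE.degree_eq {b : Fin n →₀ ℕ} {f : MvPolynomial (Fin (n + 1)) k} (hf : HatLE b f)
    (h : hatCoeff b f ≠ 0) :
    MonomialOrder.lex.degree f = embed (hatCoeff b f).natDegree b := by
  have hf0 : f ≠ 0 := by
    rintro rfl
    simp [hatCoeff] at h
  have h1 : projHat (MonomialOrder.lex.degree f) = b := by
    rcases lt_trichotomy (MonomialOrder.lex.toSyn (projHat (MonomialOrder.lex.degree f)))
      (MonomialOrder.lex.toSyn b) with h2 | h2 | h2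
    · exact absurd (hatLE_degree f b h2) h
    · exact MonomialOrder.lex.toSyn.injective h2
    · have h3 := hf _ h2
      have h4 := leadingCoeff_hatCoeff_degree hf0
      rw [h3, Polynomial.leadingCoeff_zero, eq_comm, MonomialOrder.leadingCoeff_eq_zero_iff] at h4
      exact absurd h4 hf0
  rw [← embed_projHat (MonomialOrder.lex.degree f), h1, ← natDegree_hatCoeff_degree hf0, h1]

theorem HatLE.leadingCoeff_eq {b : Fin n →₀ ℕ} {f : MvPolynomial (Fin (n + 1)) k} (hf : HatLE b f)
    (h : hatCoeff b f ≠ 0) :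
    MonomialOrder.lex.leadingCoeff f = (hatCoeff b f).leadingCoeff := by
  rw [MonomialOrder.leadingCoeff, hf.degree_eq h, ← coeff_hatCoeff]
  rfl

/-! ### Derivatives -/

theorem derivFunctional_add (p : Fin n → k) (d : Fin n →₀ ℕ) (f g : MvPolynomial (Fin n) k) :
    derivFunctional p d (f + g) = derivFunctional p d f + derivFunctional p d g := by
  unfold derivFunctional partialDeriv
  rw [foldr_pderiv_add, map_add]

theorem derivFunctional_C_mul (p : Fin n → k) (d : Fin n →₀ ℕ) (a : k)
    (f : MvPolynomial (Fin n) k) :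
    derivFunctional p d (C a * f) = a * derivFunctional p d f := by
  unfold derivFunctional partialDeriv
  rw [foldr_pderiv_smul, map_mul, eval_C]

/-- `derivFunctional` as a linear map. -/
noncomputable def derivLinear (p : Fin n → k) (d : Fin n →₀ ℕ) :
    MvPolynomial (Fin n) k →ₗ[k] k where
  toFun := derivFunctional p d
  map_add' := derivFunctional_add p d
  map_smul' a f := by rw [smul_eq_C_mul, derivFunctional_C_mul]; rfl

theorem derivFunctional_sum (p : Fin n → k) (d : Fin n →₀ ℕ) {ι : Type*} (s : Finset ι)
    (f : ι → MvPolynomial (Fin n) k) :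
    derivFunctional p d (∑ i ∈ s, f i) = ∑ i ∈ s, derivFunctional p d (f i) :=
  map_sum (derivLinear p d) f s

theorem derivFunctional_one (p : Fin n → k) (d : Fin n →₀ ℕ) [Decidable (d = 0)] :
    derivFunctional p d (1 : MvPolynomial (Fin n) k) = if d = 0 then 1 else 0 := by
  have key : ∀ l : List (Fin n), l.foldr (fun i g => (pderiv i)^[d i] g)
      (1 : MvPolynomial (Fin n) k) = if ∀ i ∈ l, d i = 0 then 1 else 0 := by
    intro l
    induction l with
    | nil => simp
    | cons i l ih =>
      rw [List.foldr_cons, ih]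
      rcases hd : d i with _ | m
      · simp [hd]
      · rw [if_neg (c := ∀ j ∈ i :: l, d j = 0) fun h => by simp [h i] at hd,
          Function.iterate_succ_apply]
        split_ifs <;> simp
  unfold derivFunctional partialDeriv
  rw [key]
  have : (∀ i ∈ List.finRange n, d i = 0) ↔ d = 0 := by simp [Finsupp.ext_iff]
  by_cases h : d = 0
  · rw [if_pos h, if_pos (this.2 h), map_one]
  · rw [if_neg h, if_neg (this.not.2 h), map_zero]

theorem iterate_derivative_X_mul (m : ℕ) (q : Polynomial k) :
    Polynomial.derivative^[m] (Polynomial.X * q) = Polynomial.X * Polynomial.derivative^[m] q +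
      m • Polynomial.derivative^[m - 1] q := by
  rw [mul_comm, Polynomial.iterate_derivative_mul_X, mul_comm]

theorem projHat_sub_single_castSucc (d : Fin (n + 1) →₀ ℕ) (i : Fin n) :
    projHat (d - Finsupp.single i.castSucc 1) = projHat d - Finsupp.single i 1 := by
  ext j
  simp [Finsupp.single_apply]

theorem projHat_sub_single_last (d : Fin (n + 1) →₀ ℕ) (m : ℕ) :
    projHat (d - Finsupp.single (Fin.last n) m) = projHat d := by
  ext j
  simp [Fin.ext_iff, j.is_lt.ne']

/-- The functional of 1 is one or zero according to whether `projHat d` vanishes. Left in this form,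
it makes the statement the constant case of the product formula that follows. -/
theorem derivFunctional_aeval_last (p : Fin (n + 1) → k) (d : Fin (n + 1) →₀ ℕ)
    (q : Polynomial k) :
    derivFunctional p d (Polynomial.aeval (X (Fin.last n)) q)
      = derivFunctional (fun i => p i.castSucc) (projHat d) 1 *
        (Polynomial.derivative^[d (Fin.last n)] q).eval (p (Fin.last n)) := by
  classical
  induction q using Polynomial.induction_on' generalizing d with
  | add q r hq hr =>
    rw [map_add, derivFunctional_add, hq, hr, iterate_map_add,
      Polynomial.eval_add, mul_add]
  | monomial m a =>
    rw [← Polynomial.C_mul_X_pow_eq_monomial, map_mul, Polynomial.aeval_C,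
      Polynomial.iterate_derivative_C_mul, Polynomial.eval_mul, Polynomial.eval_C,
      MvPolynomial.algebraMap_eq, derivFunctional_C_mul,
      mul_left_comm]
    congr 1
    induction m generalizing d with
    | zero =>
      rw [pow_zero, map_one, derivFunctional_one, derivFunctional_one]
      rcases hd : d (Fin.last n) with _ | m
      · have : d = 0 ↔ projHat d = 0 := by
          constructor
          · rintro rfl; ext; simp
          · intro h
            rw [← embed_projHat d, h, hd]
            ext i
            induction i using Fin.lastCases <;> simp
        simp [this]
      · rw [if_neg (by rintro rfl; simp at hd), Polynomial.iterate_derivative_one (by omega)]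
        simp
    | succ m ih =>
      rw [pow_succ', map_mul, Polynomial.aeval_X, derivFunctional_X_mul, ih, ih,
        projHat_sub_single_last, iterate_derivative_X_mul]
      simp
      ring

theorem derivFunctional_rename_mul_aeval (p : Fin (n + 1) → k) (d : Fin (n + 1) →₀ ℕ)
    (g : MvPolynomial (Fin n) k) (q : Polynomial k) :
    derivFunctional p d (rename Fin.castSucc g * Polynomial.aeval (X (Fin.last n)) q)
      = derivFunctional (fun i => p i.castSucc) (projHat d) g *
        (Polynomial.derivative^[d (Fin.last n)] q).eval (p (Fin.last n)) := by
  induction g using MvPolynomial.induction_on generalizing d with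
  | C a =>
    rw [rename_C, derivFunctional_C_mul, derivFunctional_aeval_last, ← mul_one (C a),
      derivFunctional_C_mul, mul_assoc]
  | add g h hg hh =>
    rw [map_add, add_mul, derivFunctional_add, hg, hh, derivFunctional_add, add_mul]
  | mul_X g i hg =>
    rw [map_mul, rename_X, mul_comm _ (X _), mul_assoc, derivFunctional_X_mul, hg, hg,
      mul_comm g, derivFunctional_X_mul, projHat_sub_single_castSucc]
    have : (d - Finsupp.single i.castSucc 1 : Fin (n + 1) →₀ ℕ) (Fin.last n) = d (Fin.last n) := by
      simp
    rw [this, projHat_apply]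
    simp
    ring

/-- The coefficient of `(X_n - c) ^ j` in the expansion of `f` at `X_n = c`. -/
noncomputable def hatTaylor (c : k) (j : ℕ) (f : MvPolynomial (Fin (n + 1)) k) :
    MvPolynomial (Fin n) k :=
  ∑ b ∈ (hatPoly f).support, monomial b ((Polynomial.taylor c (hatCoeff b f)).coeff j)

theorem coeff_hatTaylor (c : k) (j : ℕ) (f : MvPolynomial (Fin (n + 1)) k) (b : Fin n →₀ ℕ) :
    coeff b (hatTaylor c j f) = (Polynomial.taylor c (hatCoeff b f)).coeff j := by
  classical
  simp only [hatTaylor, coeff_sum, coeff_monomial, Finset.sum_ite_eq', mem_support_iff]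
  split_ifs with h
  · rfl
  · rw [not_not] at h
    rw [hatCoeff, h, map_zero, Polynomial.coeff_zero]

/-- Derivatives separate on products of a polynomial in the first variables and one in the last. An
iterated derivative is a factorial times a Hasse derivative, whose value at the point is a Taylor
coefficient; no condition on the characteristic is needed for this. -/
theorem derivFunctional_eq_hatTaylor (p : Fin (n + 1) → k) (d : Fin (n + 1) →₀ ℕ)
    (f : MvPolynomial (Fin (n + 1)) k) :
    derivFunctional p d f = ((d (Fin.last n)).factorial : k) *
      derivFunctional (fun i => p i.castSucc) (projHat d)
        (hatTaylor (p (Fin.last n)) (d (Fin.last n)) f) := by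
  conv_lhs => rw [eq_sum_hatCoeff f]
  rw [derivFunctional_sum, hatTaylor, derivFunctional_sum, Finset.mul_sum]
  refine Finset.sum_congr rfl fun b _ => ?_
  rw [derivFunctional_rename_mul_aeval, ← Polynomial.factorial_smul_hasseDeriv,
    ← mul_one (Polynomial.coeff _ _), ← C_mul_monomial, derivFunctional_C_mul,
    Polynomial.taylor_coeff]
  simp
  ring

end HatCoeff

/-! ### Slices and fibres of row sets, and counting. -/

section Rows

variable {k : Type*} {n : ℕ}

/-- The multiplicity structures of the rows are lower sets. -/
def IsLowerRows (R : Finset (Row k n)) : Prop :=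
  ∀ p d d', d' ≤ d → (p, d) ∈ R → (p, d') ∈ R

theorem mem_slice {R : Finset (Row k (n + 1))} {i : ℕ} {s : Row k n} :
    s ∈ slice R i ↔ ∃ r ∈ R, r.2 (Fin.last n) = i ∧
      (fun j => r.1 j.castSucc, projHat r.2) = s := by
  classical
  simp [slice, and_assoc]

theorem embed_le_embed {i j : ℕ} {b b' : Fin n →₀ ℕ} :
    embed i b ≤ embed j b' ↔ i ≤ j ∧ b ≤ b' := by
  simp only [Finsupp.le_def]
  constructor
  · exact fun h => ⟨by simpa using h (Fin.last n), fun l => by simpa using h l.castSucc⟩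
  · rintro ⟨h1, h2⟩ l
    induction l using Fin.lastCases with
    | last => simpa using h1
    | cast l => simpa using h2 l

theorem embed_injective2 {i j : ℕ} {b b' : Fin n →₀ ℕ} :
    embed i b = embed j b' ↔ i = j ∧ b = b' := by
  simp only [le_antisymm_iff, embed_le_embed]
  tauto

theorem IsLowerRows.slice {R : Finset (Row k (n + 1))} (hR : IsLowerRows R) (i : ℕ) :
    IsLowerRows (slice R i) := by
  intro p d d' hd h
  obtain ⟨⟨q, e⟩, hr, rfl, heq⟩ := mem_slice.1 h
  simp only [Prod.mk.injEq] at heq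
  obtain ⟨rfl, rfl⟩ := heq
  refine mem_slice.2 ⟨(q, embed (e (Fin.last n)) d'), hR _ _ _ ?_ hr, by simp, by simp⟩
  conv_rhs => rw [← embed_projHat e]
  exact embed_le_embed.2 ⟨le_rfl, hd⟩

theorem IsLowerRows.slice_subset {R : Finset (Row k (n + 1))} (hR : IsLowerRows R) {i j : ℕ}
    (hij : i ≤ j) : _root_.slice R j ⊆ _root_.slice R i := by
  intro s h
  obtain ⟨⟨q, e⟩, hr, rfl, rfl⟩ := mem_slice.1 h
  refine mem_slice.2 ⟨(q, embed i (projHat e)), hR _ _ _ ?_ hr, by simp, by simp⟩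
  conv_rhs => rw [← embed_projHat e]
  exact embed_le_embed.2 ⟨hij, le_rfl⟩

theorem slice_eq_empty {R : Finset (Row k (n + 1))} {i : ℕ} (hi : maxLast R < i) :
    slice R i = ∅ := by
  refine Finset.eq_empty_of_forall_notMem fun s hs => ?_
  obtain ⟨r, hr, rfl, -⟩ := mem_slice.1 hs
  exact absurd (Finset.le_sup (f := fun r : Row k (n + 1) => r.2 (Fin.last n)) hr) (not_le.2 hi)

theorem mem_fibre {R : Finset (Row k (n + 1))} {c : k} {r : Row k (n + 1)} :
    r ∈ fibre R c ↔ r ∈ R ∧ r.1 (Fin.last n) = c := by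
  simp [fibre]

theorem IsLowerRows.fibre {R : Finset (Row k (n + 1))} (hR : IsLowerRows R) (c : k) :
    IsLowerRows (fibre R c) := fun p d d' hd h => by
  rw [mem_fibre] at *
  exact ⟨hR p d d' hd h.1, h.2⟩

theorem fibre_subset (R : Finset (Row k (n + 1))) (c : k) : fibre R c ⊆ R :=
  fun _ h => (mem_fibre.1 h).1

/-- Deleting the last coordinates loses no rows within a slice: the last exponent is fixed there,
and the points share their last coordinate. -/
theorem sum_card_slice {R : Finset (Row k (n + 1))} {c : k} (hf : ∀ r ∈ R, r.1 (Fin.last n) = c) :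
    ∑ i ∈ Finset.range (maxLast R + 1), (slice R i).card = R.card := by
  classical
  rw [Finset.card_eq_sum_card_fiberwise (f := fun r : Row k (n + 1) => r.2 (Fin.last n))
    (t := Finset.range (maxLast R + 1))]
  · refine Finset.sum_congr rfl fun i _ => ?_
    rw [slice, Finset.card_image_of_injOn]
    rintro ⟨p, d⟩ h ⟨p', d'⟩ h' heq
    simp only [Finset.coe_filter, Set.mem_ofPred_eq] at h h'
    simp only [Prod.mk.injEq] at heq
    have h1 := hf _ h.1
    have h1' := hf _ h'.1
    simp only at h1 h1'
    refine Prod.ext (funext fun l => ?_) ?_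
    · induction l using Fin.lastCases with
      | last => simp [h1, h1']
      | cast l => exact congrFun heq.1 l
    · simp only
      rw [← embed_projHat d, ← embed_projHat d', heq.2, h.2, h'.2]
  · intro r hr
    simp only [Finset.coe_range, Set.mem_Iio, Nat.lt_succ_iff]
    exact Finset.le_sup (f := fun r : Row k (n + 1) => r.2 (Fin.last n)) hr

theorem sum_card_fibre (R : Finset (Row k (n + 1))) :
    ∑ c ∈ lastValues R, (fibre R c).card = R.card := by
  classical
  rw [Finset.card_eq_sum_card_fiberwise (f := fun r : Row k (n + 1) => r.1 (Fin.last n))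
    (t := lastValues R)]
  · rfl
  · intro r hr
    simp only [lastValues, Finset.coe_image]
    exact ⟨r, hr, rfl⟩

theorem card_lowerSetSpecial {rec : Finset (Row k n) → Finset (Fin n →₀ ℕ)}
    {R : Finset (Row k (n + 1))} {c : k} (hf : ∀ r ∈ R, r.1 (Fin.last n) = c)
    (hrec : ∀ i, (rec (slice R i)).card = (slice R i).card) :
    (lowerSetSpecial rec R).card = R.card := by
  rw [lowerSetSpecial, Finset.card_biUnion, ← sum_card_slice hf]
  · refine Finset.sum_congr rfl fun i _ => ?_
    rw [Finset.card_image_of_injective, hrec]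
    intro b b' h
    exact (embed_injective2.1 h).2
  · intro i _ j _ hij
    refine Finset.disjoint_left.2 ?_
    simp only [Finset.mem_image, not_exists, not_and]
    rintro _ ⟨b, -, rfl⟩ b' - h
    exact hij (embed_injective2.1 h).1.symm

theorem le_maxLast_of_embed_mem {rec : Finset (Row k n) → Finset (Fin n →₀ ℕ)}
    {R : Finset (Row k (n + 1))} {j : ℕ} {b : Fin n →₀ ℕ}
    (h : embed j b ∈ lowerSetSpecial rec R) :
    j ≤ maxLast R := by
  simp only [lowerSetSpecial, Finset.mem_biUnion, Finset.mem_range, Finset.mem_image,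
    embed_injective2] at h
  obtain ⟨i, hi, b, -, rfl, -⟩ := h
  omega

end Rows

/-! ### The ideal of a row set and its Taylor description. -/

section RowIdeal

variable {k : Type*} [Field k] {n : ℕ}

/-- The characteristic is zero or larger than all entries of the exponents. -/
def CharBound (R : Finset (Row k n)) : Prop :=
  ∀ r ∈ R, ∀ i, ringChar k = 0 ∨ r.2 i < ringChar k

theorem CharBound.mono {R S : Finset (Row k n)} (hR : CharBound R) (h : S ⊆ R) : CharBound S :=
  fun r hr => hR r (h hr)

/-- The largest ideal annihilated by the functionals of the rows. -/
noncomputable def rowIdeal (R : Finset (Row k n)) : Ideal (MvPolynomial (Fin n) k) where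
  carrier := {f | ∀ g, ∀ r ∈ R, derivFunctional r.1 r.2 (g * f) = 0}
  zero_mem' := fun g r _ => by
    rw [mul_zero]; exact map_zero (derivLinear r.1 r.2)
  add_mem' := fun {f f'} hf hf' g r hr => by
    rw [mul_add, derivFunctional_add, hf g r hr, hf' g r hr, add_zero]
  smul_mem' := fun h f hf g r hr => by
    rw [smul_eq_mul, ← mul_assoc]; exact hf _ r hr

/-- By the Leibniz rule, multiplying by X_j turns the functional of `d` into a combination of those
of `d` and `d - e_j`, both of which are rows when the structures are lower sets. -/
theorem mem_rowIdeal {R : Finset (Row k n)} (hR : IsLowerRows R) {f : MvPolynomial (Fin n) k} :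
    f ∈ rowIdeal R ↔ ∀ r ∈ R, derivFunctional r.1 r.2 f = 0 := by
  refine ⟨fun h r hr => by simpa using h 1 r hr, fun hf g => ?_⟩
  induction g using MvPolynomial.induction_on generalizing f with
  | C a => intro r hr; rw [derivFunctional_C_mul, hf r hr, mul_zero]
  | add p q hp hq => intro r hr; rw [add_mul, derivFunctional_add, hp hf r hr, hq hf r hr, add_zero]
  | mul_X p j hp =>
    rw [mul_assoc]
    refine hp fun r hr => ?_
    rw [derivFunctional_X_mul, hf r hr, hf (r.1, r.2 - Finsupp.single j 1)
      (hR _ _ _ tsub_le_self hr)]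
    simp

theorem rowIdeal_mono {R S : Finset (Row k n)} (h : S ⊆ R) : rowIdeal R ≤ rowIdeal S :=
  fun _ hf g r hr => hf g r (h hr)

theorem CharBound.slice {R : Finset (Row k (n + 1))} (hR : CharBound R) (i : ℕ) :
    CharBound (slice R i) := by
  intro s h l
  obtain ⟨r, hr, -, rfl⟩ := mem_slice.1 h
  exact hR r hr l.castSucc

/-- A prime divides m! only if it is at most m. This is where the hypothesis on the characteristic
takes effect. -/
theorem factorial_ne_zero {m : ℕ} (h : ringChar k = 0 ∨ m < ringChar k) :
    (m.factorial : k) ≠ 0 := by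
  intro h0
  have h1 : ringChar k ∣ m.factorial := ringChar.dvd h0
  rcases h with h | h
  · rw [h, zero_dvd_iff] at h1
    exact m.factorial_ne_zero h1
  · have hp : (ringChar k).Prime :=
      (CharP.char_is_prime_or_zero k (ringChar k)).resolve_right (by omega)
    rw [hp.dvd_factorial] at h1
    omega

theorem mem_rowIdeal_iff_hatTaylor {R : Finset (Row k (n + 1))} (hR : IsLowerRows R)
    (hc : CharBound R) {c : k} (hf : ∀ r ∈ R, r.1 (Fin.last n) = c)
    {f : MvPolynomial (Fin (n + 1)) k} :
    f ∈ rowIdeal R ↔ ∀ j, hatTaylor c j f ∈ rowIdeal (slice R j) := by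
  rw [mem_rowIdeal hR]
  constructor
  · intro h j
    rw [mem_rowIdeal (hR.slice j)]
    intro s hs
    obtain ⟨r, hr, rfl, rfl⟩ := mem_slice.1 hs
    have := h r hr
    rw [derivFunctional_eq_hatTaylor, hf r hr] at this
    exact (mul_eq_zero.1 this).resolve_left (factorial_ne_zero (hc r hr _))
  · intro h r hr
    rw [derivFunctional_eq_hatTaylor, hf r hr,
      (mem_rowIdeal (hR.slice _)).1 (h _) _ (mem_slice.2 ⟨r, hr, rfl, rfl⟩), mul_zero]

theorem hatTaylor_rename_mul (c : k) (i j : ℕ) (g : MvPolynomial (Fin n) k) :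
    hatTaylor c j (rename Fin.castSucc g *
      Polynomial.aeval (X (Fin.last n)) ((Polynomial.X - Polynomial.C c) ^ i))
      = if j = i then g else 0 := by
  ext b
  rw [coeff_hatTaylor, hatCoeff_mul_aeval, hatCoeff_rename, Polynomial.taylor_mul,
    Polynomial.taylor_C, Polynomial.taylor_pow, map_sub, Polynomial.taylor_X, Polynomial.taylor_C,
    add_sub_cancel_right, Polynomial.coeff_C_mul, Polynomial.coeff_X_pow]
  split_ifs <;> simp

theorem rename_mul_pow_mem_rowIdeal {R : Finset (Row k (n + 1))} (hR : IsLowerRows R)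
    (hc : CharBound R) {c : k} (hf : ∀ r ∈ R, r.1 (Fin.last n) = c) {i : ℕ}
    {g : MvPolynomial (Fin n) k} (hg : g ∈ rowIdeal (slice R i)) :
    rename Fin.castSucc g *
      Polynomial.aeval (X (Fin.last n)) ((Polynomial.X - Polynomial.C c) ^ i) ∈ rowIdeal R := by
  rw [mem_rowIdeal_iff_hatTaylor hR hc hf]
  intro j
  rw [hatTaylor_rename_mul]
  split_ifs with h
  · rwa [h]
  · exact zero_mem _

theorem rowIdeal_empty : rowIdeal (∅ : Finset (Row k n)) = ⊤ :=
  (Ideal.eq_top_iff_one _).2 fun _ _ h => absurd h (Finset.notMem_empty _)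

theorem aeval_pow_maxLast_mem_rowIdeal {R : Finset (Row k (n + 1))} (hR : IsLowerRows R)
    (hc : CharBound R) {c : k} (hf : ∀ r ∈ R, r.1 (Fin.last n) = c) :
    Polynomial.aeval (X (Fin.last n)) ((Polynomial.X - Polynomial.C c) ^ (maxLast R + 1))
      ∈ rowIdeal R := by
  -- The slice just above the largest last exponent is empty, so its ideal contains 1.
  have := rename_mul_pow_mem_rowIdeal hR hc hf (i := maxLast R + 1) (g := 1)
    (by rw [slice_eq_empty (Nat.lt_succ_self _), rowIdeal_empty]; trivial)
  simpa using this

end RowIdeal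

/-! ### Column heights and stacking. -/

section Columns

variable {n : ℕ}

theorem mem_iff_lt_card_of_lower {S : Finset ℕ} (hS : ∀ i j, i ≤ j → j ∈ S → i ∈ S) (j : ℕ) :
    j ∈ S ↔ j < S.card := by
  constructor
  · intro h
    have : Finset.range (j + 1) ⊆ S := fun i hi => hS i j (by simpa [Nat.lt_succ_iff] using hi) h
    simpa using Finset.card_le_card this
  · intro h
    by_contra hj
    have : S ⊆ Finset.range j := fun i hi => by
      rw [Finset.mem_range]
      by_contra hij
      exact hj (hS j i (not_lt.1 hij) hi)
    have := Finset.card_le_card this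
    rw [Finset.card_range] at this
    omega

/-- The columns of `D` are initial segments. -/
def ColumnClosed (D : Finset (Fin (n + 1) →₀ ℕ)) : Prop :=
  ∀ b j, embed j b ∈ D ↔ j < columnCount D b

theorem columnClosed_of_lower {D : Finset (Fin (n + 1) →₀ ℕ)}
    (hD : ∀ b i j, i ≤ j → embed j b ∈ D → embed i b ∈ D) : ColumnClosed D := by
  intro b j
  have h : columnCount D b =
      ((D.filter fun d => projHat d = b).image fun d => d (Fin.last n)).card := by
    rw [Finset.card_image_of_injOn, columnCount]
    intro x hx y hy hxy
    simp only [Finset.coe_filter, Set.mem_ofPred_eq] at hx hy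
    rw [← embed_projHat x, ← embed_projHat y, hx.2, hy.2]
    simp only at hxy
    rw [hxy]
  have hm : ∀ i, i ∈ (D.filter fun d => projHat d = b).image (fun d => d (Fin.last n)) ↔
      embed i b ∈ D := by
    intro i
    simp only [Finset.mem_image, Finset.mem_filter]
    constructor
    · rintro ⟨d, ⟨hd, rfl⟩, rfl⟩
      rwa [embed_projHat]
    · exact fun h => ⟨_, ⟨h, by simp⟩, by simp⟩
  rw [h, ← mem_iff_lt_card_of_lower, hm]
  intro i j hij
  rw [hm, hm]
  exact hD b i j hij

theorem ColumnClosed.mem_iff {D : Finset (Fin (n + 1) →₀ ℕ)} (hD : ColumnClosed D)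
    (a : Fin (n + 1) →₀ ℕ) : a ∈ D ↔ a (Fin.last n) < columnCount D (projHat a) := by
  rw [← hD, embed_projHat]

/-- True for arbitrary summands. Closure in the other directions is never shown combinatorially; it
follows once the set is known to consist of non-leading exponents. -/
theorem columnClosed_addLower (D₁ D₂ : Finset (Fin (n + 1) →₀ ℕ)) :
    ColumnClosed (addLower D₁ D₂) := fun b j => by
  rw [mem_addLower, columnCount_addLower]; simp

theorem card_eq_sum_columnCount {D : Finset (Fin (n + 1) →₀ ℕ)} {S : Finset (Fin n →₀ ℕ)}
    (h : ∀ d ∈ D, projHat d ∈ S) : D.card = ∑ b ∈ S, columnCount D b :=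
  Finset.card_eq_sum_card_fiberwise h

theorem card_addLower (D₁ D₂ : Finset (Fin (n + 1) →₀ ℕ)) :
    (addLower D₁ D₂).card = D₁.card + D₂.card := by
  classical
  rw [card_eq_sum_columnCount (S := (D₁ ∪ D₂).image projHat),
    card_eq_sum_columnCount (D := D₁) (S := (D₁ ∪ D₂).image projHat),
    card_eq_sum_columnCount (D := D₂) (S := (D₁ ∪ D₂).image projHat), ← Finset.sum_add_distrib]
  · exact Finset.sum_congr rfl fun b _ => columnCount_addLower _ _ _
  · exact fun d hd => Finset.mem_image_of_mem _ (Finset.mem_union_right _ hd)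
  · exact fun d hd => Finset.mem_image_of_mem _ (Finset.mem_union_left _ hd)
  · intro d hd
    simp only [addLower, Finset.mem_biUnion, Finset.mem_image] at hd
    obtain ⟨b, hb, j, -, rfl⟩ := hd
    rw [projHat_embed]
    simpa using hb

variable {ι : Type*} (f : ι → Finset (Fin (n + 1) →₀ ℕ)) (s : Finset ι)

theorem card_fold_addLower : (s.fold addLower ∅ f).card = ∑ i ∈ s, (f i).card := by
  classical
  induction s using Finset.induction with
  | empty => simp
  | insert i s hi ih => rw [Finset.fold_insert hi, card_addLower, ih, Finset.sum_insert hi]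

theorem columnCount_fold_addLower (b : Fin n →₀ ℕ) :
    columnCount (s.fold addLower ∅ f) b = ∑ i ∈ s, columnCount (f i) b := by
  classical
  induction s using Finset.induction with
  | empty => simp [columnCount]
  | insert i s hi ih => rw [Finset.fold_insert hi, columnCount_addLower, ih, Finset.sum_insert hi]

theorem columnClosed_fold_addLower : ColumnClosed (s.fold addLower ∅ f) := by
  classical
  induction s using Finset.induction with
  | empty => intro b j; simp [columnCount]
  | insert i s hi ih => rw [Finset.fold_insert hi]; exact columnClosed_addLower _ _

end Columns

/-! ### Generators of the leading coefficient ideals in k[X_last]. -/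

section LeadControl

variable {k : Type*} [Field k] {n : ℕ}

/-- The elements of `D` are the exponents that are not leading exponents of elements of `I`. -/
def IsNonLeading (D : Finset (Fin n →₀ ℕ)) (I : Ideal (MvPolynomial (Fin n) k)) : Prop :=
  ∀ a, a ∈ D ↔ ¬ ∃ f ∈ I, f ≠ 0 ∧ MonomialOrder.lex.degree f = a

/-- For each `b`, the coefficients at `b` of the elements of `I` in which no larger monomial in the
first `n` variables occurs are the multiples of `V b`. -/
def LeadControl (I : Ideal (MvPolynomial (Fin (n + 1)) k)) (V : (Fin n →₀ ℕ) → Polynomial k) :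
    Prop :=
  ∀ b, (∀ f ∈ I, HatLE b f → V b ∣ hatCoeff b f) ∧ ∃ f ∈ I, HatLE b f ∧ hatCoeff b f = V b

theorem IsNonLeading.exists_monic {D : Finset (Fin n →₀ ℕ)} {I : Ideal (MvPolynomial (Fin n) k)}
    (hD : IsNonLeading D I) {a : Fin n →₀ ℕ} (ha : a ∉ D) :
    ∃ f ∈ I, MonomialOrder.lex.Monic f ∧ MonomialOrder.lex.degree f = a := by
  have := (hD a).not.1 ha
  rw [not_not] at this
  obtain ⟨f, hf, h0, rfl⟩ := this
  have hu : (MonomialOrder.lex.leadingCoeff f)⁻¹ ≠ 0 :=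
    inv_ne_zero (MonomialOrder.leadingCoeff_ne_zero_iff.2 h0)
  have hdeg : MonomialOrder.lex.degree (C (MonomialOrder.lex.leadingCoeff f)⁻¹ * f)
      = MonomialOrder.lex.degree f := by
    rw [MonomialOrder.degree_mul (by simpa using h0) h0, MonomialOrder.degree_C, zero_add]
  refine ⟨_, I.mul_mem_left (C (MonomialOrder.lex.leadingCoeff f)⁻¹) hf, ?_, hdeg⟩
  rw [MonomialOrder.Monic, MonomialOrder.leadingCoeff, hdeg, coeff_C_mul]
  exact inv_mul_cancel₀ (MonomialOrder.leadingCoeff_ne_zero_iff.2 h0)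

/-- The degrees of the nonzero multiples of the monic polynomial `V b` start at its own degree, and
every larger degree is reached by a power of X_last. -/
theorem LeadControl.isNonLeading {I : Ideal (MvPolynomial (Fin (n + 1)) k)}
    {V : (Fin n →₀ ℕ) → Polynomial k} (hI : LeadControl I V) (hV : ∀ b, (V b).Monic)
    {D : Finset (Fin (n + 1) →₀ ℕ)}
    (hD : ∀ a, a ∈ D ↔ a (Fin.last n) < (V (projHat a)).natDegree) : IsNonLeading D I := by
  intro a
  rw [hD, ← not_le, not_iff_not]
  constructor
  · intro h
    obtain ⟨f, hf, hle, hfV⟩ := (hI (projHat a)).2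
    set q : Polynomial k := Polynomial.X ^ (a (Fin.last n) - (V (projHat a)).natDegree)
    have h1 : hatCoeff (projHat a) (f * Polynomial.aeval (X (Fin.last n)) q)
        = V (projHat a) * q := by
      rw [hatCoeff_mul_aeval, hfV]
    have h2 := (hV (projHat a)).mul
      (Polynomial.monic_X_pow (a (Fin.last n) - (V (projHat a)).natDegree))
    refine ⟨f * Polynomial.aeval (X (Fin.last n)) q, I.mul_mem_right _ hf, ?_, ?_⟩
    · intro h0
      rw [h0] at h1
      exact h2.ne_zero (by rw [← h1]; simp [hatCoeff])
    · rw [(hle.mul_aeval _).degree_eq (by rw [h1]; exact h2.ne_zero), h1,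
        (hV _).natDegree_mul (Polynomial.monic_X_pow _), Polynomial.natDegree_X_pow,
        Nat.add_sub_cancel' h, embed_projHat]
  · rintro ⟨f, hf, h0, rfl⟩
    rw [← natDegree_hatCoeff_degree h0]
    refine Polynomial.natDegree_le_of_dvd ((hI _).1 f hf (hatLE_degree f)) fun h1 => ?_
    have h2 := leadingCoeff_hatCoeff_degree h0
    rw [h1, Polynomial.leadingCoeff_zero, eq_comm, MonomialOrder.leadingCoeff_eq_zero_iff] at h2
    exact h0 h2

/-- An element of `I` of the smallest possible degree over `b` has the coefficient `V b` at `b`. -/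
theorem LeadControl.hatCoeff_eq {I : Ideal (MvPolynomial (Fin (n + 1)) k)}
    {V : (Fin n →₀ ℕ) → Polynomial k} (hI : LeadControl I V) (hV : ∀ b, (V b).Monic)
    {f : MvPolynomial (Fin (n + 1)) k} (hf : f ∈ I) (hm : MonomialOrder.lex.Monic f)
    {b : Fin n →₀ ℕ} (hd : MonomialOrder.lex.degree f = embed (V b).natDegree b) :
    HatLE b f ∧ hatCoeff b f = V b := by
  have hb : projHat (MonomialOrder.lex.degree f) = b := by rw [hd, projHat_embed]
  have hle := hatLE_degree f
  have h1 := natDegree_hatCoeff_degree hm.ne_zero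
  have h2 := leadingCoeff_hatCoeff_degree hm.ne_zero
  rw [hb] at hle h1 h2
  rw [hd, embed_last] at h1
  refine ⟨hle, ?_⟩
  -- The coefficient is a multiple of `V b`; both are monic and have equal degree.
  exact (Polynomial.eq_of_monic_of_dvd_of_natDegree_le (hV b) (h2.trans hm)
    ((hI b).1 f hf hle) h1.le)

/-- Coprimality is used twice. That of `V₁ b`, `V₂ b` makes their product a divisor. That of the
cofactors yields r₁ U₂ + r₂ U₁ = 1, and then r₁ f₁ W₂ + r₂ f₂ W₁ has the coefficient V₁ V₂ (r₁ U₂ +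
r₂ U₁). It lies in both ideals because each summand has one factor in each. -/
theorem LeadControl.inf {I₁ I₂ : Ideal (MvPolynomial (Fin (n + 1)) k)}
    {V₁ V₂ U₁ U₂ : (Fin n →₀ ℕ) → Polynomial k} {W₁ W₂ : Polynomial k}
    (h₁ : LeadControl I₁ V₁) (h₂ : LeadControl I₂ V₂)
    (hW₁ : ∀ b, W₁ = V₁ b * U₁ b) (hW₂ : ∀ b, W₂ = V₂ b * U₂ b)
    (hI₁ : Polynomial.aeval (X (Fin.last n)) W₁ ∈ I₁)
    (hI₂ : Polynomial.aeval (X (Fin.last n)) W₂ ∈ I₂) (hW : IsCoprime W₁ W₂) :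
    LeadControl (I₁ ⊓ I₂) fun b => V₁ b * V₂ b := by
  intro b
  have hW' := hW
  rw [hW₁ b, hW₂ b] at hW'
  have hU : IsCoprime (U₂ b) (U₁ b) := hW'.of_mul_left_right.of_mul_right_right.symm
  have hV : IsCoprime (V₁ b) (V₂ b) := hW'.of_mul_left_left.of_mul_right_left
  refine ⟨fun f hf hle => hV.mul_dvd ((h₁ b).1 f hf.1 hle) ((h₂ b).1 f hf.2 hle), ?_⟩
  obtain ⟨f₁, hf₁, hle₁, hc₁⟩ := (h₁ b).2
  obtain ⟨f₂, hf₂, hle₂, hc₂⟩ := (h₂ b).2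
  obtain ⟨r₁, r₂, hr⟩ := hU
  refine ⟨Polynomial.aeval (X (Fin.last n)) r₁ * (f₁ * Polynomial.aeval (X (Fin.last n)) W₂) +
    Polynomial.aeval (X (Fin.last n)) r₂ * (f₂ * Polynomial.aeval (X (Fin.last n)) W₁),
    ⟨?_, ?_⟩, ?_, ?_⟩
  · exact add_mem (Ideal.mul_mem_left _ _ (Ideal.mul_mem_right _ _ hf₁))
      (Ideal.mul_mem_left _ _ (Ideal.mul_mem_left _ _ hI₁))
  · exact add_mem (Ideal.mul_mem_left _ _ (Ideal.mul_mem_left _ _ hI₂))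
      (Ideal.mul_mem_left _ _ (Ideal.mul_mem_right _ _ hf₂))
  · exact ((hle₁.mul_aeval _).aeval_mul _).add ((hle₂.mul_aeval _).aeval_mul _)
  · rw [hatCoeff_add, hatCoeff_aeval_mul, hatCoeff_aeval_mul, hatCoeff_mul_aeval,
      hatCoeff_mul_aeval, hc₁, hc₂, hW₁ b, hW₂ b]
    linear_combination V₁ b * V₂ b * hr

end LeadControl

/-! ### One fibre: the generators are powers of X_last - c. -/

section Fibre

variable {k : Type*} [Field k] {n : ℕ} {rec : Finset (Row k n) → Finset (Fin n →₀ ℕ)}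
  {R : Finset (Row k (n + 1))}

theorem embed_mem_lowerSetSpecial
    (hrec : ∀ i, IsNonLeading (rec (slice R i)) (rowIdeal (slice R i))) {j : ℕ} {b : Fin n →₀ ℕ} :
    embed j b ∈ lowerSetSpecial rec R ↔ b ∈ rec (slice R j) := by
  simp only [lowerSetSpecial, Finset.mem_biUnion, Finset.mem_range, Finset.mem_image,
    embed_injective2]
  constructor
  · rintro ⟨i, -, b, h, rfl, rfl⟩
    exact h
  · intro h
    refine ⟨j, ?_, b, h, rfl, rfl⟩
    by_contra hj
    -- Above `maxLast R` the slice is empty and its ideal is everything, so every exponent leads and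
    -- `rec` yields nothing.
    refine (hrec j b).1 h ⟨monomial b 1, ?_, by simp, ?_⟩
    · rw [slice_eq_empty (by omega), rowIdeal_empty]
      trivial
    · classical
      rw [MonomialOrder.degree_monomial, if_neg one_ne_zero]

/-- Slices shrink as the last exponent grows, so their ideals grow and fewer exponents fail to lead.
-/
theorem columnClosed_lowerSetSpecial (hR : IsLowerRows R)
    (hrec : ∀ i, IsNonLeading (rec (slice R i)) (rowIdeal (slice R i))) :
    ColumnClosed (lowerSetSpecial rec R) := by
  refine columnClosed_of_lower fun b i j hij => ?_
  rw [embed_mem_lowerSetSpecial hrec, embed_mem_lowerSetSpecial hrec, hrec, hrec, not_imp_not]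
  rintro ⟨f, hf, h⟩
  exact ⟨f, rowIdeal_mono (hR.slice_subset hij) hf, h⟩

theorem columnCount_lowerSetSpecial_le (hR : IsLowerRows R)
    (hrec : ∀ i, IsNonLeading (rec (slice R i)) (rowIdeal (slice R i))) (b : Fin n →₀ ℕ) :
    columnCount (lowerSetSpecial rec R) b ≤ maxLast R + 1 := by
  rw [← not_lt, ← columnClosed_lowerSetSpecial hR hrec]
  simp [lowerSetSpecial, embed_injective2]

theorem leadControl_rowIdeal (hR : IsLowerRows R) (hc : CharBound R) {c : k}
    (hf : ∀ r ∈ R, r.1 (Fin.last n) = c)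
    (hrec : ∀ i, IsNonLeading (rec (slice R i)) (rowIdeal (slice R i))) :
    LeadControl (rowIdeal R) fun b =>
      (Polynomial.X - Polynomial.C c) ^ columnCount (lowerSetSpecial rec R) b := by
  have hcol := columnClosed_lowerSetSpecial hR hrec
  refine fun b => ⟨fun f hfI hle => ?_, ?_⟩
  -- Divisibility means that the Taylor coefficients of index below the column height vanish.
  · rw [Polynomial.X_sub_C_pow_dvd_iff, Polynomial.X_pow_dvd_iff]
    intro j hj
    rw [← hcol, embed_mem_lowerSetSpecial hrec, hrec] at hj
    rw [← Polynomial.taylor_apply, ← coeff_hatTaylor]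
    by_contra h0
    -- A nonzero one would make `b` the leading exponent of the `j`-th Taylor part, an element of
    -- the slice ideal, although `b` does not lead there.
    refine hj ⟨_, (mem_rowIdeal_iff_hatTaylor hR hc hf).1 hfI j, ?_, ?_⟩
    · intro h
      rw [h] at h0
      exact h0 rfl
    · apply MonomialOrder.lex.toSyn.injective
      apply le_antisymm
      · rw [MonomialOrder.degree_le_iff]
        intro b' hb'
        by_contra hlt
        rw [mem_support_iff, coeff_hatTaylor, hle b' (not_le.1 hlt)] at hb'
        simp at hb'
      · exact MonomialOrder.le_degree (mem_support_iff.2 h0)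
  -- At the column height `b` leads in the slice ideal; a monic witness times the power of X_last -
  -- c has the generator as its coefficient.
  · have hb : b ∉ rec (slice R (columnCount (lowerSetSpecial rec R) b)) := by
      rw [← embed_mem_lowerSetSpecial hrec, hcol]
      exact lt_irrefl _
    obtain ⟨g, hg, hm, rfl⟩ := (hrec _).exists_monic hb
    refine ⟨_, rename_mul_pow_mem_rowIdeal hR hc hf hg, hatLE_rename.mul_aeval _, ?_⟩
    rw [hatCoeff_mul_aeval, hatCoeff_rename, hm.coeff_degree, map_one, one_mul]

end Fibre

/-! ### Corners of a lower set. -/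

section LimitingSet

variable {n : ℕ} {D : Set (Fin n →₀ ℕ)}

theorem exists_mem_limitingSet_le {c : Fin n →₀ ℕ} (hc : c ∉ D) :
    ∃ e ∈ limitingSet D, e ≤ c := by
  induction c using WellFoundedLT.induction with
  | ind c ih =>
    by_cases h : ∀ i, c i ≠ 0 → c - Finsupp.single i 1 ∈ D
    · exact ⟨c, ⟨hc, h⟩, le_rfl⟩
    · push Not at h
      obtain ⟨i, hi, hiD⟩ := h
      obtain ⟨e, he, hle⟩ := ih _ (lt_of_le_of_ne tsub_le_self fun h => by
        have := DFunLike.congr_fun h i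
        simp at this
        omega) hiD
      exact ⟨e, he, hle.trans tsub_le_self⟩

/-- If `a < b`, some coordinate drops, so `a` lies below a lower neighbour of `b`. Thus corners are
minimal outside `D`. -/
theorem mem_of_lt_of_mem_limitingSet (hD : IsLowerSet D) {a b : Fin n →₀ ℕ}
    (hb : b ∈ limitingSet D) (hab : a < b) : a ∈ D := by
  obtain ⟨hle, i, hi⟩ := Finsupp.lt_def.1 hab
  refine hD (fun j => ?_) (hb.2 i (by omega))
  by_cases hj : i = j
  · subst hj
    simp
    omega
  · simpa [Finsupp.single_apply, hj] using hle j

theorem eq_of_le_of_mem_limitingSet (hD : IsLowerSet D) {a b : Fin n →₀ ℕ}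
    (ha : a ∉ D) (hb : b ∈ limitingSet D) (hab : a ≤ b) : a = b := by
  by_contra h
  exact ha (mem_of_lt_of_mem_limitingSet hD hb (lt_of_le_of_ne hab h))

/-- A nonzero corner is an element of `D` plus a unit vector. -/
theorem limitingSet_finite (hD : D.Finite) : (limitingSet D).Finite := by
  refine ((Set.finite_singleton (0 : Fin n →₀ ℕ)).union
    (Set.Finite.image2 (fun d i => d + Finsupp.single i 1) hD
      (Set.finite_univ (α := Fin n)))).subset fun b hb => ?_
  by_cases h : b = 0
  · exact Or.inl h
  · obtain ⟨i, hi⟩ := Finsupp.ne_iff.1 h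
    refine Or.inr ⟨_, hb.2 i hi, i, trivial, tsub_add_cancel_of_le ?_⟩
    simpa [Nat.one_le_iff_ne_zero] using hi

end LimitingSet

/-! ### Quotient basis, reduced Gröbner basis and the inner loop. -/

section ReducedBasis

variable {k : Type*} [Field k] {n : ℕ} {I : Ideal (MvPolynomial (Fin n) k)}
  {D : Finset (Fin n →₀ ℕ)}

/-- Monomial multiples of elements of `I` lead at all exponents above a leading one. -/
theorem IsNonLeading.isLowerSet (hD : IsNonLeading D I) :
    IsLowerSet (D : Set (Fin n →₀ ℕ)) := by
  intro a b hba ha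
  rw [Finset.mem_coe] at *
  by_contra hb
  obtain ⟨f, hf, hm, rfl⟩ := hD.exists_monic hb
  refine (hD a).1 ha ⟨monomial (a - MonomialOrder.lex.degree f) 1 * f, I.mul_mem_left _ hf, ?_, ?_⟩
  · exact mul_ne_zero (by simp) hm.ne_zero
  · classical
    rw [MonomialOrder.degree_mul (by simp) hm.ne_zero, MonomialOrder.degree_monomial,
      if_neg one_ne_zero, tsub_add_cancel_of_le hba]

theorem IsNonLeading.degree_notMem (hD : IsNonLeading D I) {f : MvPolynomial (Fin n) k}
    (hf : f ∈ I) (h0 : f ≠ 0) : MonomialOrder.lex.degree f ∉ D :=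
  fun h => (hD _).1 h ⟨f, hf, h0, rfl⟩

theorem IsNonLeading.eq_zero (hD : IsNonLeading D I) {f : MvPolynomial (Fin n) k} (hf : f ∈ I)
    (h : ∀ c ∈ f.support, c ∈ D) : f = 0 := by
  by_contra h0
  exact hD.degree_notMem hf h0 (h _ (MonomialOrder.degree_mem_support h0))

theorem mk_monomial (I : Ideal (MvPolynomial (Fin n) k)) (c : Fin n →₀ ℕ) (a : k) :
    Ideal.Quotient.mk I (monomial c a) = a • Ideal.Quotient.mk I (monomial c 1) := by
  conv_lhs => rw [← mul_one a, ← smul_eq_mul, ← smul_monomial]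
  rfl

theorem IsNonLeading.isQuotientBasis (hD : IsNonLeading D I) :
    IsQuotientBasis MonomialOrder.lex D I where
  mem_iff := hD
  linearIndependent := by
    rw [Fintype.linearIndependent_iff]
    intro g hg d
    have h1 : ∑ d : D, monomial (d : Fin n →₀ ℕ) (g d) ∈ I := by
      rw [← Ideal.Quotient.eq_zero_iff_mem, map_sum, ← hg]
      refine Finset.sum_congr rfl fun d _ => ?_
      exact mk_monomial I d (g d)
    have hcoeff : ∀ c, coeff c (∑ d : D, monomial (d : Fin n →₀ ℕ) (g d))
        = ∑ d : D, if (d : Fin n →₀ ℕ) = c then g d else 0 := by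
      classical
      intro c
      simp only [coeff_sum, coeff_monomial]
    have h2 := hD.eq_zero h1 fun c hc => by
      rw [mem_support_iff, hcoeff] at hc
      obtain ⟨d, -, hd⟩ := Finset.exists_ne_zero_of_sum_ne_zero hc
      rw [ite_ne_right_iff] at hd
      exact hd.1 ▸ d.2
    have h3 := hcoeff d
    rw [h2, coeff_zero, Finset.sum_eq_single d] at h3
    · simpa using h3.symm
    · intro b _ hb
      rw [if_neg (Subtype.coe_ne_coe.2 hb)]
    · simp
  span_eq_top := by
    rw [eq_top_iff]
    rintro x -
    obtain ⟨f, rfl⟩ := Ideal.Quotient.mk_surjective x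
    -- Dividing by all nonzero elements of `I` leaves a remainder supported on non-leading
    -- exponents, without having a Gröbner basis yet.
    obtain ⟨g, r, hfr, -, hr⟩ := MonomialOrder.lex.div_set (B := {f | f ∈ I ∧ f ≠ 0})
      (fun b hb => (MonomialOrder.leadingCoeff_ne_zero_iff.2 hb.2).isUnit) f
    have hrD : ∀ c ∈ r.support, c ∈ D := fun c hc => by
      rw [hD]
      rintro ⟨b, hb, hb0, rfl⟩
      exact hr _ hc b ⟨hb, hb0⟩ le_rfl
    have h : Ideal.Quotient.mk I f = Ideal.Quotient.mk I r := by
      rw [Ideal.Quotient.eq, hfr, add_sub_cancel_right, Finsupp.linearCombination_apply]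
      exact sum_mem fun b _ => I.mul_mem_left _ b.2.1
    rw [h, r.as_sum, map_sum]
    refine sum_mem fun c hc => ?_
    rw [mk_monomial]
    exact Submodule.smul_mem _ _ (Submodule.subset_span
      (Set.mem_range_self (⟨c, hrD c hc⟩ : D)))

theorem IsQuotientBasis.finrank_eq {m : MonomialOrder (Fin n)} (h : IsQuotientBasis m D I) :
    Module.finrank k (MvPolynomial (Fin n) k ⧸ I) = D.card := by
  rw [Module.finrank_eq_card_basis (Module.Basis.mk h.linearIndependent h.span_eq_top.ge),
    Fintype.card_coe]

/-- `G` consists of one monic element of `I` for each leading exponent in `E`, with all other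
exponents in `D`. -/
structure IsReducedSet (I : Ideal (MvPolynomial (Fin n) k)) (D : Finset (Fin n →₀ ℕ))
    (E : Set (Fin n →₀ ℕ)) (G : Set (MvPolynomial (Fin n) k)) : Prop where
  mem : ∀ g ∈ G, g ∈ I
  monic : ∀ g ∈ G, MonomialOrder.lex.Monic g
  degree_mem : ∀ g ∈ G, MonomialOrder.lex.degree g ∈ E
  tail_mem : ∀ g ∈ G, ∀ c ∈ g.support, c ≠ MonomialOrder.lex.degree g → c ∈ D
  exists_degree : ∀ a ∈ E, ∃ g ∈ G, MonomialOrder.lex.degree g = a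

/-- Two monic elements with the same leading exponent differ by an element of `I` supported in `D`,
which is zero. -/
theorem IsReducedSet.degree_injOn {E : Set (Fin n →₀ ℕ)} {G : Set (MvPolynomial (Fin n) k)}
    (hD : IsNonLeading D I) (hG : IsReducedSet I D E G) :
    Set.InjOn MonomialOrder.lex.degree G := by
  intro f hf g hg h
  rw [← sub_eq_zero]
  refine hD.eq_zero (I.sub_mem (hG.mem f hf) (hG.mem g hg)) fun c hc => ?_
  have hne : c ≠ MonomialOrder.lex.degree f := by
    rintro rfl
    rw [mem_support_iff, coeff_sub, (hG.monic f hf).coeff_degree, h,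
      (hG.monic g hg).coeff_degree, sub_self] at hc
    exact hc rfl
  by_cases hcf : c ∈ f.support
  · exact hG.tail_mem f hf c hcf hne
  · refine hG.tail_mem g hg c ?_ (h ▸ hne)
    rw [mem_support_iff] at *
    rw [coeff_sub, not_not.1 hcf, zero_sub, neg_ne_zero] at hc
    exact hc

theorem IsReducedSet.isReducedGroebnerBasis {G : Set (MvPolynomial (Fin n) k)}
    (hD : IsNonLeading D I) (hG : IsReducedSet I D (limitingSet (D : Set (Fin n →₀ ℕ))) G) :
    IsReducedGroebnerBasis MonomialOrder.lex G I := by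
  have hle : ∀ c, c ∉ D → ∃ g ∈ G, MonomialOrder.lex.degree g ≤ c := fun c hc => by
    obtain ⟨e, he, hec⟩ := exists_mem_limitingSet_le (D := (D : Set (Fin n →₀ ℕ))) (c := c) hc
    obtain ⟨g, hg, rfl⟩ := hG.exists_degree e he
    exact ⟨g, hg, hec⟩
  refine ⟨?_, ?_, fun f hf h0 => hle _ (hD.degree_notMem hf h0), hG.monic, ?_⟩
  · refine Set.Finite.of_finite_image ?_ (hG.degree_injOn hD)
    refine (limitingSet_finite D.finite_toSet).subset ?_
    rintro _ ⟨g, hg, rfl⟩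
    exact hG.degree_mem g hg
  · refine le_antisymm (Ideal.span_le.2 hG.mem) fun f hf => ?_
    obtain ⟨g, r, hfr, -, hr⟩ := MonomialOrder.lex.div_set (B := G)
      (fun b hb => by rw [hG.monic b hb]; exact isUnit_one) f
    have hs : Finsupp.linearCombination (MvPolynomial (Fin n) k)
        (fun b : G => (b : MvPolynomial (Fin n) k)) g ∈ Ideal.span G := by
      rw [Finsupp.linearCombination_apply]
      exact sum_mem fun b _ => Ideal.mul_mem_left _ _ (Ideal.subset_span b.2)
    -- Every exponent outside `D` lies above a corner, hence above a leading exponent of `G`; so the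
    -- remainder is supported in `D`, and it lies in `I`.
    have hr0 : r = 0 := by
      refine hD.eq_zero ?_ fun c hc => ?_
      · rw [← add_sub_cancel_left (Finsupp.linearCombination (MvPolynomial (Fin n) k)
          (fun b : G => (b : MvPolynomial (Fin n) k)) g) r, ← hfr]
        exact I.sub_mem hf (Ideal.span_le.2 hG.mem hs)
      · by_contra hcD
        obtain ⟨b, hb, hbc⟩ := hle c hcD
        exact hr c hc b hb hbc
    rw [hfr, hr0, add_zero]
    exact hs
  · intro g hg g' hg' hne c hc hlec
    -- At the leading exponent of `g`, divisibility would identify two corners; at a tail exponent,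
    -- which is in `D`, it would put the corner of `g'` into `D`.
    have hg'D := (hG.degree_mem g' hg').1
    by_cases hcg : c = MonomialOrder.lex.degree g
    · exact hne (hG.degree_injOn hD hg' hg (eq_of_le_of_mem_limitingSet hD.isLowerSet hg'D
        (hG.degree_mem g hg) (hcg ▸ hlec)))
    · exact hg'D (hD.isLowerSet hlec (hG.tail_mem g hg c hc hcg))

/-- The remainder upon division by the reduced polynomials with smaller leading exponents. -/
theorem IsReducedSet.insert_remainder {P : Set (Fin n →₀ ℕ)} {G : Set (MvPolynomial (Fin n) k)}
    (hD : IsNonLeading D I) (hG : IsReducedSet I D P G) {a : Fin n →₀ ℕ}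
    (ha : a ∈ limitingSet (D : Set (Fin n →₀ ℕ)))
    (hP : ∀ e, e ∈ P ↔ e ∈ limitingSet (D : Set (Fin n →₀ ℕ)) ∧ e ≺[MonomialOrder.lex] a)
    {f r : MvPolynomial (Fin n) k} (hf : f ∈ I) (hfm : MonomialOrder.lex.Monic f)
    (hfa : MonomialOrder.lex.degree f = a) (hr : IsRemainder MonomialOrder.lex f G r) :
    IsReducedSet I D (insert a P) (insert r G) := by
  obtain ⟨⟨g, hfr, hdeg⟩, hred⟩ := hr
  set s := Finsupp.linearCombination (MvPolynomial (Fin n) k)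
    (fun b : G => (b : MvPolynomial (Fin n) k)) g with hs
  have hsum : s = ∑ b ∈ g.support, (b : MvPolynomial (Fin n) k) * g b := by
    rw [hs, Finsupp.linearCombination_apply, Finsupp.sum]
    exact Finset.sum_congr rfl fun b _ => by rw [smul_eq_mul, mul_comm]
  have hsI : s ∈ I := by
    rw [hsum]
    exact sum_mem fun b _ => I.mul_mem_right _ (hG.mem b b.2)
  have hrI : r ∈ I := by
    rw [← add_sub_cancel_left s r, ← hfr]
    exact I.sub_mem hf hsI
  -- Nothing subtracted in the division reaches `a`: a product with leading exponent `a` would have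
  -- its divisor's corner below the corner `a`, hence equal to it, whereas that corner is strictly
  -- smaller in the order.
  have hterm : ∀ b : G, ∀ c, a ≼[MonomialOrder.lex] c →
      coeff c ((b : MvPolynomial (Fin n) k) * g b) = 0 := by
    intro b c hac
    by_cases hb0 : (b : MvPolynomial (Fin n) k) * g b = 0
    · rw [hb0, coeff_zero]
    apply MonomialOrder.coeff_eq_zero_of_lt (m := MonomialOrder.lex)
    refine lt_of_lt_of_le (lt_of_le_of_ne (hfa ▸ hdeg b) fun heq => ?_) hac
    have heq := MonomialOrder.lex.toSyn.injective heq
    rw [MonomialOrder.degree_mul (left_ne_zero_of_mul hb0) (right_ne_zero_of_mul hb0)] at heq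
    have hbP := (hP _).1 (hG.degree_mem b b.2)
    have := eq_of_le_of_mem_limitingSet hD.isLowerSet hbP.1.1 ha (heq ▸ le_self_add)
    rw [this] at hbP
    exact lt_irrefl _ hbP.2
  have hscoeff : ∀ c, a ≼[MonomialOrder.lex] c → coeff c s = 0 := fun c hac => by
    rw [hsum, coeff_sum]
    exact Finset.sum_eq_zero fun b _ => hterm b c hac
  have hrcoeff : ∀ c, a ≼[MonomialOrder.lex] c → coeff c r = coeff c f := fun c hac => by
    rw [hfr, coeff_add, hscoeff c hac, zero_add]
  have hra : coeff a r = 1 := by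
    rw [hrcoeff a le_rfl, ← hfa, hfm.coeff_degree]
  have hrdeg : MonomialOrder.lex.degree r = a := by
    apply MonomialOrder.lex.toSyn.injective
    apply le_antisymm
    · rw [MonomialOrder.degree_le_iff]
      intro c hc
      by_contra hlt
      have hlt := not_le.1 hlt
      rw [mem_support_iff, hrcoeff c hlt.le,
        MonomialOrder.coeff_eq_zero_of_lt (m := MonomialOrder.lex) (hfa.symm ▸ hlt)] at hc
      exact hc rfl
    · exact MonomialOrder.le_degree (mem_support_iff.2 (by rw [hra]; exact one_ne_zero))
  refine ⟨?_, ?_, ?_, ?_, ?_⟩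
  · rintro h (rfl | h1)
    exacts [hrI, hG.mem h h1]
  · rintro h (rfl | h1)
    · rw [MonomialOrder.Monic, MonomialOrder.leadingCoeff, hrdeg, hra]
    · exact hG.monic h h1
  · rintro h (rfl | h1)
    exacts [Or.inl hrdeg, Or.inr (hG.degree_mem h h1)]
  · rintro h (rfl | h1)
    · intro c hc hne
      -- A tail exponent outside `D` lies above a corner that precedes `a`. The polynomial for this
      -- corner is already among the divisors, so the term would have been reduced.
      by_contra hcD
      obtain ⟨e, he, hec⟩ := exists_mem_limitingSet_le (D := (D : Set (Fin n →₀ ℕ))) (c := c) hcD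
      have hca : c ≺[MonomialOrder.lex] a := by
        refine lt_of_le_of_ne (hrdeg ▸ MonomialOrder.le_degree hc) fun h => hne ?_
        rw [hrdeg]
        exact MonomialOrder.lex.toSyn.injective h
      obtain ⟨b, hb, rfl⟩ := hG.exists_degree e ((hP e).2
        ⟨he, lt_of_le_of_lt (MonomialOrder.lex.toSyn_monotone hec) hca⟩)
      exact hred c hc b hb hec
    · exact hG.tail_mem h h1
  · rintro e (rfl | h1)
    · exact ⟨r, Or.inl rfl, hrdeg⟩
    · obtain ⟨b, hb, h⟩ := hG.exists_degree e h1
      exact ⟨b, Or.inr hb, h⟩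

/-- The inner loop can be carried out and completes a partial reduced basis. -/
theorem IsReducedSet.innerLoop {cand : (Fin n →₀ ℕ) → MvPolynomial (Fin n) k → Prop}
    (hD : IsNonLeading D I)
    (hcand : ∀ a ∈ limitingSet (D : Set (Fin n →₀ ℕ)), (∃ f, cand a f) ∧ ∀ f, cand a f →
      f ∈ I ∧ MonomialOrder.lex.Monic f ∧ MonomialOrder.lex.degree f = a)
    (L : List (Fin n →₀ ℕ)) {P : Set (Fin n →₀ ℕ)} {G : Set (MvPolynomial (Fin n) k)}
    (hL : L.Pairwise fun a b => a ≺[MonomialOrder.lex] b)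
    (hP : ∀ a ∈ P, ∀ b ∈ L, a ≺[MonomialOrder.lex] b)
    (hE : ∀ a, a ∈ limitingSet (D : Set (Fin n →₀ ℕ)) ↔ a ∈ P ∨ a ∈ L)
    (hG : IsReducedSet I D P G) :
    (∃ G', InnerLoop cand G L G') ∧ ∀ G', InnerLoop cand G L G' →
      IsReducedSet I D (limitingSet (D : Set (Fin n →₀ ℕ))) G' := by
  induction L generalizing P G with
  | nil =>
    have : limitingSet (D : Set (Fin n →₀ ℕ)) = P := by ext a; simp [hE]
    rw [this]
    exact ⟨⟨G, rfl⟩, fun G' h => h ▸ hG⟩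
  | cons a L ih =>
    rw [List.pairwise_cons] at hL
    have ha : a ∈ limitingSet (D : Set (Fin n →₀ ℕ)) := (hE a).2 (Or.inr (by simp))
    -- Since the list is increasing, the corners already treated are exactly those before `a`.
    have hPa : ∀ e, e ∈ P ↔ e ∈ limitingSet (D : Set (Fin n →₀ ℕ)) ∧
        e ≺[MonomialOrder.lex] a := by
      intro e
      rw [hE]
      constructor
      · exact fun he => ⟨Or.inl he, hP e he a (by simp)⟩
      · rintro ⟨he | he, hlt⟩
        · exact he
        · rcases List.mem_cons.1 he with rfl | he
          · exact absurd hlt (lt_irrefl _)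
          · exact absurd hlt (hL.1 e he).asymm
    have step : ∀ f r, cand a f → IsRemainder MonomialOrder.lex f G r →
        (∃ G', InnerLoop cand (insert r G) L G') ∧ ∀ G', InnerLoop cand (insert r G) L G' →
          IsReducedSet I D (limitingSet (D : Set (Fin n →₀ ℕ))) G' := by
      intro f r hf hr
      obtain ⟨h1, h2, h3⟩ := (hcand a ha).2 f hf
      refine ih hL.2 ?_ ?_ (hG.insert_remainder hD ha hPa h1 h2 h3 hr)
      · rintro b (rfl | hb) c hc
        exacts [hL.1 c hc, hP b hb c (List.mem_cons_of_mem _ hc)]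
      · intro b
        rw [hE, List.mem_cons, Set.mem_insert_iff]
        tauto
    constructor
    · obtain ⟨f, hf⟩ := (hcand a ha).1
      obtain ⟨g, r, hfr, hdeg, hr⟩ := MonomialOrder.lex.div_set (B := G)
        (fun b hb => by rw [hG.monic b hb]; exact isUnit_one) f
      obtain ⟨G', hG'⟩ := (step f r hf ⟨⟨g, hfr, hdeg⟩, hr⟩).1
      exact ⟨G', f, r, hf, ⟨⟨g, hfr, hdeg⟩, hr⟩, hG'⟩
    · rintro G' ⟨f, r, hf, hr, h⟩
      exact (step f r hf hr).2 G' h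

theorem isReducedSet_empty : IsReducedSet I D ∅ (∅ : Set (MvPolynomial (Fin n) k)) :=
  ⟨by simp, by simp, by simp, by simp, by simp⟩

theorem exists_sorted_list {E : Set (Fin n →₀ ℕ)} (hE : E.Finite) :
    ∃ L : List (Fin n →₀ ℕ), L.Pairwise (fun a b => a ≺[MonomialOrder.lex] b) ∧
      ∀ a, a ∈ L ↔ a ∈ E := by
  classical
  refine ⟨((hE.toFinset.image MonomialOrder.lex.toSyn).sort (· ≤ ·)).map
    MonomialOrder.lex.toSyn.symm, ?_, fun a => ?_⟩
  · rw [List.pairwise_map]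
    simpa using (Finset.sortedLT_sort (hE.toFinset.image MonomialOrder.lex.toSyn)).pairwise
  · simp [Finset.mem_sort]

end ReducedBasis

/-! ### The polynomials of a single fibre. -/

section SpecialCase

variable {k : Type*} [Field k] {n : ℕ} {rec : Finset (Row k n) → Finset (Fin n →₀ ℕ)}
  {R : Finset (Row k (n + 1))} {c : k}

theorem aeval_X_sub_C_pow (c : k) (i : ℕ) :
    Polynomial.aeval (X (Fin.last n) : MvPolynomial (Fin (n + 1)) k)
      ((Polynomial.X - Polynomial.C c) ^ i) = (X (Fin.last n) - C c) ^ i := by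
  simp [MvPolynomial.algebraMap_eq]

theorem rename_mul_pow_monic_degree {g : MvPolynomial (Fin n) k} (hg : MonomialOrder.lex.Monic g)
    (c : k) (i : ℕ) :
    MonomialOrder.lex.Monic (rename Fin.castSucc g * (X (Fin.last n) - C c) ^ i) ∧
    MonomialOrder.lex.degree (rename Fin.castSucc g * (X (Fin.last n) - C c) ^ i)
      = embed i (MonomialOrder.lex.degree g) := by
  rw [← aeval_X_sub_C_pow]
  have hc : hatCoeff (MonomialOrder.lex.degree g) (rename Fin.castSucc g *
      Polynomial.aeval (X (Fin.last n)) ((Polynomial.X - Polynomial.C c) ^ i))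
      = (Polynomial.X - Polynomial.C c) ^ i := by
    rw [hatCoeff_mul_aeval, hatCoeff_rename, hg.coeff_degree, map_one, one_mul]
  have hm := (Polynomial.monic_X_sub_C c).pow i
  have hle := (hatLE_rename (g := g)).mul_aeval ((Polynomial.X - Polynomial.C c) ^ i)
  have h0 := hm.ne_zero
  rw [← hc] at h0
  constructor
  · rw [MonomialOrder.Monic, hle.leadingCoeff_eq h0, hc]
    exact hm
  · rw [hle.degree_eq h0, hc, Polynomial.natDegree_pow, Polynomial.natDegree_X_sub_C, mul_one]

theorem embed_sub_single_castSucc (i : ℕ) (b : Fin n →₀ ℕ) (l : Fin n) :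
    embed i b - Finsupp.single l.castSucc 1 = embed i (b - Finsupp.single l 1) := by
  ext j
  induction j using Fin.lastCases with
  | last => simp
  | cast j => simp [Finsupp.single_apply]

theorem embed_sub_single_last (i m : ℕ) (b : Fin n →₀ ℕ) :
    embed i b - Finsupp.single (Fin.last n) m = embed (i - m) b := by
  ext j
  induction j using Fin.lastCases with
  | last => simp
  | cast j => simp [Fin.ext_iff, j.is_lt.ne']

theorem IsPolySpecial.isReducedSet {recP : Finset (Row k n) → Set (MvPolynomial (Fin n) k) → Prop}
    (hR : IsLowerRows R) (hc : CharBound R) (hf : ∀ r ∈ R, r.1 (Fin.last n) = c)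
    (hrec : ∀ i, IsNonLeading (rec (slice R i)) (rowIdeal (slice R i)))
    (hrecP : ∀ i G, recP (slice R i) G → IsReducedSet (rowIdeal (slice R i)) (rec (slice R i))
      (limitingSet (rec (slice R i) : Set (Fin n →₀ ℕ))) G)
    {G : Set (MvPolynomial (Fin (n + 1)) k)} (hG : IsPolySpecial rec recP R c G) :
    IsReducedSet (rowIdeal R) (lowerSetSpecial rec R)
      (limitingSet (lowerSetSpecial rec R : Set (Fin (n + 1) →₀ ℕ))) G := by
  have hcol := columnClosed_lowerSetSpecial hR hrec
  have hlow : IsLowerSet (lowerSetSpecial rec R : Set (Fin (n + 1) →₀ ℕ)) :=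
    ((leadControl_rowIdeal hR hc hf hrec).isNonLeading
      (fun b => (Polynomial.monic_X_sub_C c).pow _) fun a => by
        rw [Polynomial.natDegree_pow, Polynomial.natDegree_X_sub_C, mul_one,
          hcol.mem_iff]).isLowerSet
  obtain ⟨Gt, hGt, rfl⟩ := hG
  -- The pure power is the case `f = 1`, `i = maxLast R + 1` of the other family, where the slice
  -- ideal is everything.
  have key : ∀ g, (g = (X (Fin.last n) - C c) ^ (maxLast R + 1) ∨
      ∃ i ≤ maxLast R, ∃ f ∈ Gt i, g = rename Fin.castSucc f * (X (Fin.last n) - C c) ^ i) →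
      ∃ i, ∃ f ∈ rowIdeal (slice R i), MonomialOrder.lex.Monic f ∧
        (∀ b ∈ f.support, b ≠ MonomialOrder.lex.degree f → b ∈ rec (slice R i)) ∧
        g = rename Fin.castSucc f * (X (Fin.last n) - C c) ^ i := by
    rintro g (rfl | ⟨i, hi, f, hfG, rfl⟩)
    · refine ⟨maxLast R + 1, 1, ?_, MonomialOrder.monic_one, fun b hb hne => ?_, by simp⟩
      · rw [slice_eq_empty (Nat.lt_succ_self _), rowIdeal_empty]
        trivial
      · classical
        rw [mem_support_iff, coeff_one] at hb
        refine absurd ?_ hne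
        rw [MonomialOrder.degree_one]
        by_contra h
        exact hb (if_neg (Ne.symm h))
    · have h := hrecP i _ (hGt i hi)
      exact ⟨i, f, h.mem f hfG, h.monic f hfG, h.tail_mem f hfG, rfl⟩
  refine ⟨?_, ?_, fun g hg => hg.2, ?_, ?_⟩
  · rintro g ⟨hg, -⟩
    obtain ⟨i, f, hfI, -, -, rfl⟩ := key g hg
    rw [← aeval_X_sub_C_pow]
    exact rename_mul_pow_mem_rowIdeal hR hc hf hfI
  · rintro g ⟨hg, -⟩
    obtain ⟨i, f, -, hm, -, rfl⟩ := key g hg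
    exact (rename_mul_pow_monic_degree hm c i).1
  · rintro g ⟨hg, hE⟩ e he hne
    obtain ⟨i, f, -, hm, ht, rfl⟩ := key g hg
    rw [(rename_mul_pow_monic_degree hm c i).2] at hE hne
    rw [← embed_projHat e] at hne ⊢
    rw [mem_support_iff, ← embed_projHat e, ← coeff_hatCoeff, ← aeval_X_sub_C_pow,
      hatCoeff_mul_aeval, hatCoeff_rename, Polynomial.coeff_C_mul] at he
    have hle : e (Fin.last n) ≤ i := by
      have := Polynomial.le_natDegree_of_ne_zero (right_ne_zero_of_mul he)
      rwa [Polynomial.natDegree_pow, Polynomial.natDegree_X_sub_C, mul_one] at this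
    -- A tail exponent over the leading one of `f` is strictly below the corner; any other lies over
    -- a tail exponent of `f`, which belongs to the `i`-th layer and hence to all lower ones.
    by_cases hb : projHat e = MonomialOrder.lex.degree f
    · refine mem_of_lt_of_mem_limitingSet hlow hE (lt_of_le_of_ne ?_ hne)
      exact embed_le_embed.2 ⟨hle, hb.le⟩
    · refine hlow (embed_le_embed.2 ⟨hle, le_rfl⟩) ?_
      rw [Finset.mem_coe, embed_mem_lowerSetSpecial hrec]
      exact ht _ (mem_support_iff.2 (by simpa using left_ne_zero_of_mul he)) hb
  · intro a ha
    have ha' := ha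
    rw [← embed_projHat a] at ha ⊢
    set i := a (Fin.last n)
    set b := projHat a
    have hmem : ∀ l, b l ≠ 0 → embed i (b - Finsupp.single l 1) ∈ lowerSetSpecial rec R := by
      intro l hl
      have := ha.2 l.castSucc (by simpa using hl)
      rwa [embed_sub_single_castSucc] at this
    rcases le_or_gt i (maxLast R) with hi | hi
    · have hb : b ∈ limitingSet (rec (slice R i) : Set (Fin n →₀ ℕ)) := by
        refine ⟨fun h => ha.1 ((embed_mem_lowerSetSpecial hrec).2 h), fun l hl => ?_⟩
        exact (embed_mem_lowerSetSpecial hrec).1 (hmem l hl)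
      obtain ⟨f, hfG, hdeg⟩ := (hrecP i _ (hGt i hi)).exists_degree b hb
      have h2 := (rename_mul_pow_monic_degree ((hrecP i _ (hGt i hi)).monic f hfG) c i).2
      rw [hdeg] at h2
      exact ⟨_, ⟨Or.inr ⟨i, hi, f, hfG, rfl⟩, h2 ▸ ha⟩, h2⟩
    -- All lower neighbours have last exponent at most `maxLast R`. This forces `i = maxLast R + 1`,
    -- and `b = 0` because a neighbour in another direction would keep the last exponent `i`.
    · have h1 := ha.2 (Fin.last n) (by simp; omega)
      rw [embed_sub_single_last] at h1
      have h2 := le_maxLast_of_embed_mem h1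
      have hi' : i = maxLast R + 1 := by omega
      have hb : b = 0 := by
        ext l
        by_contra hl
        exact absurd (le_maxLast_of_embed_mem (hmem l hl)) (by omega)
      have h3 := (rename_mul_pow_monic_degree (MonomialOrder.monic_one (R := k) (σ := Fin n)
        (m := MonomialOrder.lex)) c (maxLast R + 1)).2
      rw [map_one, one_mul, MonomialOrder.degree_one, ← hi', ← hb] at h3
      rw [← h3, hi'] at ha
      exact ⟨_, ⟨Or.inl rfl, ha⟩, by rw [← hi', h3]⟩

end SpecialCase

/-! ### Merging fibres by Bézout. -/

section Merge

variable {k : Type*} [Field k] {n : ℕ} {J : k → Ideal (MvPolynomial (Fin (n + 1)) k)}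
  {Dc : k → Finset (Fin (n + 1) →₀ ℕ)} {w : k → ℕ}

/-- The properties of the ideal, the lower set and the largest last exponent of the fibre over `c`
that are used for merging. -/
structure IsFibreData (J : k → Ideal (MvPolynomial (Fin (n + 1)) k))
    (Dc : k → Finset (Fin (n + 1) →₀ ℕ)) (w : k → ℕ) (c : k) : Prop where
  closed : ColumnClosed (Dc c)
  le : ∀ b, columnCount (Dc c) b ≤ w c + 1
  control : LeadControl (J c) fun b =>
    (Polynomial.X - Polynomial.C c) ^ columnCount (Dc c) b
  mem : Polynomial.aeval (X (Fin.last n)) ((Polynomial.X - Polynomial.C c) ^ (w c + 1)) ∈ J c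

/-- The ideal `I` and the lower set `D` are the result of merging the fibres over `done`. -/
structure IsMergeState (J : k → Ideal (MvPolynomial (Fin (n + 1)) k))
    (Dc : k → Finset (Fin (n + 1) →₀ ℕ)) (w : k → ℕ) (done : List k)
    (I : Ideal (MvPolynomial (Fin (n + 1)) k)) (D : Finset (Fin (n + 1) →₀ ℕ)) : Prop where
  mem_iff : ∀ f, f ∈ I ↔ ∀ c ∈ done, f ∈ J c
  closed : ColumnClosed D
  count : ∀ b, columnCount D b = (done.map fun c => columnCount (Dc c) b).sum
  le : ∀ c ∈ done, ∀ b, columnCount (Dc c) b ≤ w c + 1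
  control : LeadControl I fun b =>
    (done.map fun c => (Polynomial.X - Polynomial.C c) ^ columnCount (Dc c) b).prod
  mem : Polynomial.aeval (X (Fin.last n))
    (done.map fun c => (Polynomial.X - Polynomial.C c) ^ (w c + 1)).prod ∈ I

theorem monic_prod_X_sub_C_pow (l : List k) (e : k → ℕ) :
    (l.map fun c => (Polynomial.X - Polynomial.C c) ^ e c).prod.Monic := by
  induction l with
  | nil => exact Polynomial.monic_one
  | cons c l ih =>
    rw [List.map_cons, List.prod_cons]
    exact ((Polynomial.monic_X_sub_C c).pow _).mul ih

theorem natDegree_prod_X_sub_C_pow (l : List k) (e : k → ℕ) :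
    (l.map fun c => (Polynomial.X - Polynomial.C c) ^ e c).prod.natDegree = (l.map e).sum := by
  induction l with
  | nil => simp
  | cons c l ih =>
    rw [List.map_cons, List.prod_cons,
      ((Polynomial.monic_X_sub_C c).pow _).natDegree_mul (monic_prod_X_sub_C_pow l e), ih]
    simp

theorem prod_X_sub_C_pow_mul (l : List k) (e v : k → ℕ) (h : ∀ c ∈ l, v c ≤ e c) :
    (l.map fun c => (Polynomial.X - Polynomial.C c) ^ e c).prod
      = (l.map fun c => (Polynomial.X - Polynomial.C c) ^ v c).prod *
        (l.map fun c => (Polynomial.X - Polynomial.C c) ^ (e c - v c)).prod := by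
  rw [← List.prod_map_mul]
  refine congrArg List.prod (List.map_congr_left fun c hc => ?_)
  rw [← pow_add, Nat.add_sub_cancel' (h c hc)]

/-- Distinct last coordinates give coprime linear factors. This supplies both the merging of ideals
and the cofactors of the algorithm. -/
theorem isCoprime_prod_X_sub_C_pow {l : List k} {c : k} (hc : c ∉ l) (e : k → ℕ) (m : ℕ) :
    IsCoprime (l.map fun c => (Polynomial.X - Polynomial.C c) ^ e c).prod
      ((Polynomial.X - Polynomial.C c) ^ m) := by
  induction l with
  | nil => exact isCoprime_one_left
  | cons b l ih =>
    rw [List.mem_cons, not_or] at hc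
    rw [List.map_cons, List.prod_cons]
    exact (Polynomial.isCoprime_X_sub_C_of_isUnit_sub
      (sub_ne_zero.2 (Ne.symm hc.1)).isUnit).pow.mul_left (ih hc.2)

theorem IsFibreData.isNonLeading {c : k} (h : IsFibreData J Dc w c) :
    IsNonLeading (Dc c) (J c) :=
  h.control.isNonLeading (fun b => (Polynomial.monic_X_sub_C c).pow _) fun a => by
    rw [Polynomial.natDegree_pow, Polynomial.natDegree_X_sub_C, mul_one, h.closed.mem_iff]

theorem IsMergeState.isNonLeading {done : List k} {I : Ideal (MvPolynomial (Fin (n + 1)) k)}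
    {D : Finset (Fin (n + 1) →₀ ℕ)} (h : IsMergeState J Dc w done I D) : IsNonLeading D I :=
  h.control.isNonLeading (fun b => monic_prod_X_sub_C_pow _ _) fun a => by
    rw [natDegree_prod_X_sub_C_pow, h.closed.mem_iff, h.count]

theorem isMergeState_nil : IsMergeState J Dc w [] ⊤ ∅ where
  mem_iff f := by simp
  closed b j := by simp [columnCount]
  count b := by simp [columnCount]
  le := by simp
  control b := by
    classical
    refine ⟨fun f _ _ => one_dvd _, rename Fin.castSucc (monomial b 1), trivial, ?_, ?_⟩
    · have := hatLE_rename (g := monomial b (1 : k))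
      rwa [MonomialOrder.degree_monomial, if_neg one_ne_zero] at this
    · simp [hatCoeff_rename]
  mem := trivial

theorem IsFibreData.isMergeState {c : k} (h : IsFibreData J Dc w c) :
    IsMergeState J Dc w [c] (J c) (Dc c) where
  mem_iff f := by simp
  closed := h.closed
  count b := by simp
  le := by simpa using h.le
  control := by simpa using h.control
  mem := by simpa using h.mem

theorem IsMergeState.append {done : List k} {I : Ideal (MvPolynomial (Fin (n + 1)) k)}
    {D : Finset (Fin (n + 1) →₀ ℕ)} (h : IsMergeState J Dc w done I D) {c : k}
    (hc : IsFibreData J Dc w c) (hcd : c ∉ done) :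
    IsMergeState J Dc w (done ++ [c]) (I ⊓ J c) (addLower D (Dc c)) where
  mem_iff f := by
    rw [Ideal.mem_inf, h.mem_iff]
    simp only [List.mem_append, List.mem_singleton, or_imp, forall_and, forall_eq]
  closed := columnClosed_addLower _ _
  count b := by simp [columnCount_addLower, h.count]
  le b hb := by
    rcases List.mem_append.1 hb with hb | hb
    · exact h.le b hb
    · rw [List.mem_singleton.1 hb]
      exact hc.le
  control := by
    simp only [List.map_append, List.prod_append, List.map_singleton, List.prod_singleton]
    exact h.control.inf hc.control
      (fun b => prod_X_sub_C_pow_mul done _ _ fun a ha => h.le a ha b)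
      (fun b => by rw [← pow_add, Nat.add_sub_cancel' (hc.le b)]) h.mem hc.mem
      (isCoprime_prod_X_sub_C_pow hcd _ _)
  mem := by
    simp only [List.map_append, List.prod_append, List.map_singleton, List.prod_singleton]
    rw [map_mul]
    exact ⟨Ideal.mul_mem_right _ _ h.mem, Ideal.mul_mem_left _ _ hc.mem⟩

theorem ColumnClosed.gltLast_eq {D : Finset (Fin (n + 1) →₀ ℕ)} (hD : ColumnClosed D)
    (a : Fin (n + 1) →₀ ℕ) : gltLast a D = columnCount D (projHat a) := by
  unfold gltLast
  have : {j | embed j (projHat a) ∉ D} = Set.Ici (columnCount D (projHat a)) := by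
    ext j
    simp [hD (projHat a) j]
  rw [this, csInf_Ici]

theorem IsReducedSet.exists_isGLP {I : Ideal (MvPolynomial (Fin (n + 1)) k)}
    {D : Finset (Fin (n + 1) →₀ ℕ)} {G : Set (MvPolynomial (Fin (n + 1)) k)}
    (hcol : ColumnClosed D)
    (hG : IsReducedSet I D (limitingSet (D : Set (Fin (n + 1) →₀ ℕ))) G)
    (a : Fin (n + 1) →₀ ℕ) : ∃ p, IsGLP a D G p := by
  have : glt a D ∉ (D : Set (Fin (n + 1) →₀ ℕ)) := by
    rw [glt, hcol.gltLast_eq, Finset.mem_coe, hcol]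
    exact lt_irrefl _
  obtain ⟨e, he, hle⟩ := exists_mem_limitingSet_le this
  obtain ⟨f, hf, hdeg⟩ := hG.exists_degree e he
  exact ⟨_, e, he, hle, f, hf, hdeg, rfl⟩

theorem IsGLP.mem_monic_degree {I : Ideal (MvPolynomial (Fin (n + 1)) k)}
    {D : Finset (Fin (n + 1) →₀ ℕ)} {G : Set (MvPolynomial (Fin (n + 1)) k)}
    (hcol : ColumnClosed D)
    (hG : IsReducedSet I D (limitingSet (D : Set (Fin (n + 1) →₀ ℕ))) G)
    {a : Fin (n + 1) →₀ ℕ} {p : MvPolynomial (Fin (n + 1)) k} (hp : IsGLP a D G p) :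
    p ∈ I ∧ MonomialOrder.lex.Monic p ∧
      MonomialOrder.lex.degree p = embed (columnCount D (projHat a)) (projHat a) := by
  classical
  obtain ⟨e, he, hle, f, hf, rfl, rfl⟩ := hp
  refine ⟨I.mul_mem_right _ (hG.mem f hf),
    (hG.monic f hf).mul MonomialOrder.monic_monomial_one, ?_⟩
  rw [MonomialOrder.degree_mul (hG.monic f hf).ne_zero (by simp), MonomialOrder.degree_monomial,
    if_neg one_ne_zero, add_tsub_cancel_of_le hle, glt, hcol.gltLast_eq]

/-- A corner rests directly on its column, so its projection determines it. -/
theorem last_eq_of_mem_limitingSet {D : Finset (Fin (n + 1) →₀ ℕ)} (hcol : ColumnClosed D)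
    {a : Fin (n + 1) →₀ ℕ} (ha : a ∈ limitingSet (D : Set (Fin (n + 1) →₀ ℕ))) :
    a (Fin.last n) = columnCount D (projHat a) := by
  have h1 := ha.1
  have h2 := ha.2 (Fin.last n)
  rw [Finset.mem_coe, hcol.mem_iff] at h1 h2
  rw [projHat_sub_single_last] at h2
  simp at h2
  omega

/-- Both inputs have minimal degree over `projHat a`, so their full coefficients there are known.
The Bézout identity collapses the combination to the product of these coefficients, whose degree is
the stacked column height. -/
theorem IsMergeState.candidate {done : List k} {I : Ideal (MvPolynomial (Fin (n + 1)) k)}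
    {D : Finset (Fin (n + 1) →₀ ℕ)} (h : IsMergeState J Dc w done I D) {c : k}
    (hc : IsFibreData J Dc w c) (hcd : c ∉ done) (hdone : ∀ b ∈ done, ColumnClosed (Dc b))
    {G Gc : Set (MvPolynomial (Fin (n + 1)) k)}
    (hG : IsReducedSet I D (limitingSet (D : Set (Fin (n + 1) →₀ ℕ))) G)
    (hGc : IsReducedSet (J c) (Dc c) (limitingSet (Dc c : Set (Fin (n + 1) →₀ ℕ))) Gc)
    {a : Fin (n + 1) →₀ ℕ}
    (ha : a ∈ limitingSet (addLower D (Dc c) : Set (Fin (n + 1) →₀ ℕ))) :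
    (∃ f, IsCandidate Dc w done D G c Gc a f) ∧ ∀ f, IsCandidate Dc w done D G c Gc a f →
      f ∈ I ⊓ J c ∧ MonomialOrder.lex.Monic f ∧ MonomialOrder.lex.degree f = a := by
  have hglt : (done.map fun b =>
        (Polynomial.X - Polynomial.C b) ^ (w b + 1 - gltLast a (Dc b)))
      = done.map fun b =>
        (Polynomial.X - Polynomial.C b) ^ (w b + 1 - columnCount (Dc b) (projHat a)) :=
    List.map_congr_left fun b hb => by rw [(hdone b hb).gltLast_eq]
  have hprod : (done.map fun b => (X (Fin.last n) - C b) ^ (w b + 1)).prod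
      = Polynomial.aeval (X (Fin.last n) : MvPolynomial (Fin (n + 1)) k)
        (done.map fun b => (Polynomial.X - Polynomial.C b) ^ (w b + 1)).prod := by
    rw [map_list_prod, List.map_map]
    refine congrArg List.prod (List.map_congr_left fun b _ => ?_)
    rw [Function.comp_apply, aeval_X_sub_C_pow]
  constructor
  · obtain ⟨f₁, hf₁⟩ := hG.exists_isGLP h.closed a
    obtain ⟨f₂, hf₂⟩ := hGc.exists_isGLP hc.closed a
    obtain ⟨r₁, r₂, hr⟩ := (isCoprime_prod_X_sub_C_pow hcd
      (fun b => w b + 1 - gltLast a (Dc b)) (w c + 1 - gltLast a (Dc c))).symm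
    exact ⟨_, f₁, f₂, r₁, r₂, hf₁, hf₂, hr, rfl⟩
  · rintro f ⟨f₁, f₂, r₁, r₂, hf₁, hf₂, hr, rfl⟩
    obtain ⟨hI₁, hm₁, hd₁⟩ := hf₁.mem_monic_degree h.closed hG
    obtain ⟨hI₂, hm₂, hd₂⟩ := hf₂.mem_monic_degree hc.closed hGc
    rw [hglt, hc.closed.gltLast_eq] at hr
    rw [hprod, ← aeval_X_sub_C_pow]
    obtain ⟨hle₁, hc₁⟩ := h.control.hatCoeff_eq (fun b => monic_prod_X_sub_C_pow _ _) hI₁ hm₁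
      (by rw [hd₁, natDegree_prod_X_sub_C_pow, h.count])
    obtain ⟨hle₂, hc₂⟩ := hc.control.hatCoeff_eq
      (fun b => (Polynomial.monic_X_sub_C c).pow _) hI₂ hm₂
      (by rw [hd₂, Polynomial.natDegree_pow, Polynomial.natDegree_X_sub_C, mul_one])
    have hw := hc.le (projHat a)
    set W₁ := (done.map fun b => (Polynomial.X - Polynomial.C b) ^ (w b + 1)).prod with hW₁
    set W₂ := (Polynomial.X - Polynomial.C c) ^ (w c + 1) with hW₂
    set f := Polynomial.aeval (X (Fin.last n)) r₁ * (f₁ * Polynomial.aeval (X (Fin.last n)) W₂) +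
      Polynomial.aeval (X (Fin.last n)) r₂ * (f₂ * Polynomial.aeval (X (Fin.last n)) W₁) with hf
    have hle : HatLE (projHat a) f :=
      ((hle₁.mul_aeval _).aeval_mul _).add ((hle₂.mul_aeval _).aeval_mul _)
    set V := ((done ++ [c]).map fun b =>
      (Polynomial.X - Polynomial.C b) ^ columnCount (Dc b) (projHat a)).prod with hV
    have hcf : hatCoeff (projHat a) f = V := by
      rw [hf, hatCoeff_add, hatCoeff_aeval_mul, hatCoeff_aeval_mul, hatCoeff_mul_aeval,
        hatCoeff_mul_aeval, hc₁, hc₂, hW₁, hW₂, hV,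
        prod_X_sub_C_pow_mul done _ _ fun b hb => h.le b hb (projHat a),
        ← Nat.add_sub_cancel' hw, pow_add, List.map_append, List.prod_append]
      simp only [List.map_cons, List.map_nil, List.prod_singleton]
      -- After each `w + 1` is split as column height plus rest, the product of the two coefficients
      -- is a common factor and the Bézout identity remains.
      linear_combination (done.map fun b => (Polynomial.X - Polynomial.C b) ^
        columnCount (Dc b) (projHat a)).prod * (Polynomial.X - Polynomial.C c) ^
          columnCount (Dc c) (projHat a) * hr
    have hVm : V.Monic := monic_prod_X_sub_C_pow _ _
    have hne : hatCoeff (projHat a) f ≠ 0 := hcf ▸ hVm.ne_zero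
    refine ⟨⟨?_, ?_⟩, ?_, ?_⟩
    · exact add_mem (Ideal.mul_mem_left _ _ (Ideal.mul_mem_right _ _ hI₁))
        (Ideal.mul_mem_left _ _ (Ideal.mul_mem_left _ _ h.mem))
    · exact add_mem (Ideal.mul_mem_left _ _ (Ideal.mul_mem_left _ _ hc.mem))
        (Ideal.mul_mem_left _ _ (Ideal.mul_mem_right _ _ hI₂))
    · rw [MonomialOrder.Monic, hle.leadingCoeff_eq hne, hcf]
      exact hVm
    · rw [hle.degree_eq hne, hcf, hV, natDegree_prod_X_sub_C_pow,
        ← (h.append hc hcd).count, ← last_eq_of_mem_limitingSet (columnClosed_addLower _ _) ha,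
        embed_projHat]

/-- The final ideal and lower set depend only on the fibres, hence the quantifier over `G` comes
after them: all runs have the same target. -/
theorem IsMergeState.outerLoop {Gc : k → Set (MvPolynomial (Fin (n + 1)) k)} (rest : List k)
    {done : List k} {I : Ideal (MvPolynomial (Fin (n + 1)) k)} {D : Finset (Fin (n + 1) →₀ ℕ)}
    (h : IsMergeState J Dc w done I D) (hnodup : (done ++ rest).Nodup)
    (hc : ∀ c ∈ done ++ rest, IsFibreData J Dc w c)
    (hGc : ∀ c ∈ rest,
      IsReducedSet (J c) (Dc c) (limitingSet (Dc c : Set (Fin (n + 1) →₀ ℕ))) (Gc c)) :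
    ∃ I' D', IsMergeState J Dc w (done ++ rest) I' D' ∧
      ∀ G, IsReducedSet I D (limitingSet (D : Set (Fin (n + 1) →₀ ℕ))) G →
        (∃ G', OuterLoop Dc w Gc done D G rest G') ∧
        ∀ G', OuterLoop Dc w Gc done D G rest G' →
          IsReducedSet I' D' (limitingSet (D' : Set (Fin (n + 1) →₀ ℕ))) G' := by
  induction rest generalizing done I D with
  | nil =>
    refine ⟨I, D, by simpa using h, fun G hG => ⟨⟨G, rfl⟩, fun G' h' => ?_⟩⟩
    exact h' ▸ hG
  | cons c rest ih =>
    have hcd : c ∉ done := fun hcd => by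
      rw [List.nodup_append] at hnodup
      exact hnodup.2.2 c hcd c (by simp) rfl
    have hcF := hc c (by simp)
    have h' := h.append hcF hcd
    have happ : done ++ c :: rest = (done ++ [c]) ++ rest := by simp
    rw [happ] at hnodup hc
    obtain ⟨I', D', hm, hG'⟩ := ih h' hnodup hc fun b hb => hGc b (List.mem_cons_of_mem _ hb)
    refine ⟨I', D', happ ▸ hm, fun G hG => ?_⟩
    have hinner := fun L hL hE => IsReducedSet.innerLoop (P := ∅) (G := ∅)
      (cand := IsCandidate Dc w done D G c (Gc c)) h'.isNonLeading
      (fun a ha => h.candidate hcF hcd (fun b hb => (hc b (by simp [hb])).closed) hG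
        (hGc c (by simp)) ha) L hL (by simp) hE isReducedSet_empty
    constructor
    · obtain ⟨L, hL, hE⟩ := exists_sorted_list
        (limitingSet_finite (addLower D (Dc c)).finite_toSet)
      obtain ⟨⟨Gh, hGh⟩, hred⟩ := hinner L hL (fun a => by simp [hE])
      obtain ⟨G', h1⟩ := (hG' Gh (hred Gh hGh)).1
      exact ⟨G', L, Gh, hL, hE, hGh, h1⟩
    · rintro G' ⟨L, Gh, hL, hE, hGh, h1⟩
      exact (hG' Gh ((hinner L hL (fun a => by simp [hE])).2 Gh hGh)).2 G' h1

theorem exists_isMergeState_isPolyGeneral {Gc : k → Set (MvPolynomial (Fin (n + 1)) k)}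
    {cs : List k} (hnodup : cs.Nodup) (hc : ∀ c ∈ cs, IsFibreData J Dc w c)
    (hGc : ∀ c ∈ cs,
      IsReducedSet (J c) (Dc c) (limitingSet (Dc c : Set (Fin (n + 1) →₀ ℕ))) (Gc c)) :
    ∃ I D, IsMergeState J Dc w cs I D ∧ (∃ G, IsPolyGeneral Dc w Gc cs G) ∧
      ∀ G, IsPolyGeneral Dc w Gc cs G →
        IsReducedSet I D (limitingSet (D : Set (Fin (n + 1) →₀ ℕ))) G := by
  cases cs with
  | nil =>
    refine ⟨⊤, ∅, isMergeState_nil, ⟨{1}, rfl⟩, ?_⟩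
    rintro G rfl
    refine ⟨by simp, ?_, ?_, ?_, ?_⟩
    · rintro g rfl
      exact MonomialOrder.monic_one
    · rintro g rfl
      rw [MonomialOrder.degree_one]
      exact ⟨by simp, by simp⟩
    · rintro g rfl e he hne
      classical
      rw [mem_support_iff, coeff_one] at he
      rw [MonomialOrder.degree_one] at hne
      exact absurd (if_neg (Ne.symm hne)) he
    · rintro a ha
      refine ⟨1, rfl, ?_⟩
      rw [MonomialOrder.degree_one]
      ext i
      by_contra hi
      exact absurd (ha.2 i (Ne.symm hi)) (by simp)
  | cons c rest =>
    obtain ⟨I, D, hm, h⟩ := (hc c (by simp)).isMergeState.outerLoop rest hnodup hc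
      fun b hb => hGc b (List.mem_cons_of_mem _ hb)
    exact ⟨I, D, hm, h _ (hGc c (by simp))⟩

end Merge

/-! ### The induction step on the dimension. -/

section General

variable {k : Type*} [Field k] {n : ℕ} {rec : Finset (Row k n) → Finset (Fin n →₀ ℕ)}
  {R : Finset (Row k (n + 1))}

/-- The merge without polynomials: it determines the lower set independently of any run of the
algorithm. -/
theorem exists_isMergeState {J : k → Ideal (MvPolynomial (Fin (n + 1)) k)}
    {Dc : k → Finset (Fin (n + 1) →₀ ℕ)} {w : k → ℕ} {l : List k} (hl : l.Nodup)
    (hc : ∀ c ∈ l, IsFibreData J Dc w c) : ∃ I D, IsMergeState J Dc w l I D := by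
  induction l using List.reverseRecOn with
  | nil => exact ⟨_, _, isMergeState_nil⟩
  | append_singleton l c ih =>
    rw [List.nodup_append] at hl
    obtain ⟨I, D, h⟩ := ih hl.1 fun b hb => hc b (by simp [hb])
    exact ⟨_, _, h.append (hc c (by simp)) fun hcl => hl.2.2 c hcl c (by simp) rfl⟩

theorem mem_rowIdeal_iff_fibre {f : MvPolynomial (Fin (n + 1)) k} :
    f ∈ rowIdeal R ↔ ∀ c ∈ lastValues R, f ∈ rowIdeal (fibre R c) :=
  ⟨fun h c _ => rowIdeal_mono (fibre_subset R c) h, fun h g r hr => by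
    classical
    exact h (r.1 (Fin.last n)) (Finset.mem_image_of_mem _ hr) g r (mem_fibre.2 ⟨hr, rfl⟩)⟩

theorem isFibreData_rowIdeal (hR : IsLowerRows R) (hc : CharBound R)
    (hrec : ∀ S, IsLowerRows S → CharBound S → IsNonLeading (rec S) (rowIdeal S)) (c : k) :
    IsFibreData (fun c => rowIdeal (fibre R c)) (fun c => lowerSetSpecial rec (fibre R c))
      (fun c => maxLast (fibre R c)) c := by
  have hR' := hR.fibre c
  have hc' := hc.mono (fibre_subset R c)
  have hf : ∀ r ∈ fibre R c, r.1 (Fin.last n) = c := fun r hr => (mem_fibre.1 hr).2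
  have hrec' := fun i => hrec _ (hR'.slice i) (hc'.slice i)
  exact ⟨columnClosed_lowerSetSpecial hR' hrec', columnCount_lowerSetSpecial_le hR' hrec',
    leadControl_rowIdeal hR' hc' hf hrec', aeval_pow_maxLast_mem_rowIdeal hR' hc' hf⟩

/-- Membership in all fibre ideals and sums of column heights are insensitive to the order of the
fibres, so any enumeration gives the same ideal and lower set. -/
theorem IsMergeState.eq_rowIdeal {Dc : k → Finset (Fin (n + 1) →₀ ℕ)} {w : k → ℕ} {cs : List k}
    (hcs : cs.Nodup) (hmem : ∀ c, c ∈ cs ↔ c ∈ lastValues R)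
    {I : Ideal (MvPolynomial (Fin (n + 1)) k)} {D : Finset (Fin (n + 1) →₀ ℕ)}
    (h : IsMergeState (fun c => rowIdeal (fibre R c)) Dc w cs I D) :
    I = rowIdeal R ∧ D = (lastValues R).fold addLower ∅ Dc := by
  classical
  constructor
  · ext f
    rw [h.mem_iff, mem_rowIdeal_iff_fibre]
    simp only [hmem]
  · have hl : lastValues R = cs.toFinset := by ext c; simp [hmem]
    ext a
    rw [h.closed.mem_iff, (columnClosed_fold_addLower _ _).mem_iff, h.count,
      columnCount_fold_addLower, hl, List.sum_toFinset _ hcs]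

theorem card_fold_lowerSetSpecial (hR : IsLowerRows R) (hc : CharBound R)
    (hcard : ∀ S, IsLowerRows S → CharBound S → (rec S).card = S.card) :
    ((lastValues R).fold addLower ∅ fun c => lowerSetSpecial rec (fibre R c)).card = R.card := by
  rw [card_fold_addLower, ← sum_card_fibre]
  refine Finset.sum_congr rfl fun c _ => card_lowerSetSpecial (c := c)
    (fun r hr => (mem_fibre.1 hr).2) fun i => ?_
  exact hcard _ ((hR.fibre c).slice i) ((hc.mono (fibre_subset R c)).slice i)

/-- The lower set in dimension `n + 1` consists of the exponents that are not leading, if this holds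
in dimension `n`. -/
theorem isNonLeading_fold_lowerSetSpecial (hR : IsLowerRows R) (hc : CharBound R)
    (hrec : ∀ S, IsLowerRows S → CharBound S → IsNonLeading (rec S) (rowIdeal S)) :
    IsNonLeading ((lastValues R).fold addLower ∅ fun c => lowerSetSpecial rec (fibre R c))
      (rowIdeal R) := by
  obtain ⟨I, D, h⟩ := exists_isMergeState (lastValues R).nodup_toList
    fun c _ => isFibreData_rowIdeal hR hc hrec c
  obtain ⟨hI, hD⟩ := h.eq_rowIdeal (lastValues R).nodup_toList fun c => Finset.mem_toList
  exact hI ▸ hD ▸ h.isNonLeading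

theorem isPolyGeneral_rowIdeal {recP : Finset (Row k n) → Set (MvPolynomial (Fin n) k) → Prop}
    (hR : IsLowerRows R) (hc : CharBound R)
    (hrec : ∀ S, IsLowerRows S → CharBound S → IsNonLeading (rec S) (rowIdeal S))
    (hrecP : ∀ S, IsLowerRows S → CharBound S → ∀ G, recP S G →
      IsReducedSet (rowIdeal S) (rec S) (limitingSet (rec S : Set (Fin n →₀ ℕ))) G)
    {cs : List k} (hcs : cs.Nodup) (hmem : ∀ c, c ∈ cs ↔ c ∈ lastValues R)
    {Gc : k → Set (MvPolynomial (Fin (n + 1)) k)}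
    (hGc : ∀ c ∈ cs, IsPolySpecial rec recP (fibre R c) c (Gc c)) :
    (∃ G, IsPolyGeneral (fun c => lowerSetSpecial rec (fibre R c))
      (fun c => maxLast (fibre R c)) Gc cs G) ∧
    ∀ G, IsPolyGeneral (fun c => lowerSetSpecial rec (fibre R c))
      (fun c => maxLast (fibre R c)) Gc cs G →
      IsReducedSet (rowIdeal R)
        ((lastValues R).fold addLower ∅ fun c => lowerSetSpecial rec (fibre R c))
        (limitingSet ((lastValues R).fold addLower ∅ fun c => lowerSetSpecial rec (fibre R c) :
          Finset (Fin (n + 1) →₀ ℕ))) G := by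
  obtain ⟨I, D, h, hG⟩ := exists_isMergeState_isPolyGeneral (Gc := Gc) hcs
    (fun c _ => isFibreData_rowIdeal hR hc hrec c) fun c hcc =>
      (hGc c hcc).isReducedSet (hR.fibre c) (hc.mono (fibre_subset R c))
        (fun r hr => (mem_fibre.1 hr).2)
        (fun i => hrec _ ((hR.fibre c).slice i) ((hc.mono (fibre_subset R c)).slice i))
        (fun i => hrecP _ ((hR.fibre c).slice i) ((hc.mono (fibre_subset R c)).slice i))
  obtain ⟨rfl, rfl⟩ := h.eq_rowIdeal hcs hmem
  exact hG

end General

/-! ### Rows of a point set, and low-dimensional counting. -/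

section Rows

variable {k : Type*} {n : ℕ}

theorem PointsWithMult.mem_rows {H : PointsWithMult k n} {p : Fin n → k} {d : Fin n →₀ ℕ} :
    (p, d) ∈ H.rows ↔ p ∈ H.pts ∧ d ∈ H.mult p := by
  classical
  simp only [PointsWithMult.rows, Finset.mem_biUnion, Finset.mem_image, Prod.mk.injEq]
  constructor
  · rintro ⟨p, hp, d, hd, rfl, rfl⟩
    exact ⟨hp, hd⟩
  · rintro ⟨hp, hd⟩
    exact ⟨p, hp, d, hd, rfl, rfl⟩

theorem PointsWithMult.card_rows (H : PointsWithMult k n) :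
    H.rows.card = H.numFunctionals := by
  classical
  rw [PointsWithMult.rows, Finset.card_biUnion, PointsWithMult.numFunctionals]
  · exact Finset.sum_congr rfl fun p _ =>
      Finset.card_image_of_injective _ fun d d' h => (Prod.mk.inj h).2
  · intro p _ q _ hpq
    refine Finset.disjoint_left.2 ?_
    simp only [Finset.mem_image, not_exists, not_and]
    rintro _ ⟨d, -, rfl⟩ d' - h
    exact hpq (Prod.mk.inj h).1.symm

theorem PointsWithMult.isLowerRows (H : PointsWithMult k n) : IsLowerRows H.rows := by
  intro p d d' hd h
  rw [PointsWithMult.mem_rows] at *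
  exact ⟨h.1, H.lower p h.1 hd h.2⟩

open scoped Classical in
theorem card_image_snd (S : Finset (Row k 0)) : (S.image Prod.snd).card = S.card :=
  Finset.card_image_of_injective _ (Function.injective_of_subsingleton _)

theorem lowerSetOf_zero (R : Finset (Row k 1)) (a : Fin 1 →₀ ℕ) :
    a ∈ lowerSetOf 0 R ↔ a (Fin.last 0) < R.card := by
  simp only [lowerSetOf, Finset.mem_image, Finset.mem_range]
  constructor
  · rintro ⟨j, hj, rfl⟩
    simpa using hj
  · refine fun h => ⟨_, h, ?_⟩
    ext i
    rw [Fin.fin_one_eq_zero i]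
    simp

end Rows

/-! ### The base case, reduced to zero variables. -/

section OneVariable

variable {k : Type*} [Field k]

-- Over zero variables there is one point and one exponent: the ideal is everything if there is no
-- row and zero otherwise.
open scoped Classical in
theorem isNonLeading_image_snd (S : Finset (Row k 0)) :
    IsNonLeading (S.image Prod.snd) (rowIdeal S) := by
  intro a
  rcases S.eq_empty_or_nonempty with rfl | ⟨s, hs⟩
  · refine iff_of_false (by simp) (not_not.2 ⟨1, ?_, one_ne_zero, Subsingleton.elim _ _⟩)
    rw [rowIdeal_empty]
    trivial
  · refine iff_of_true (Finset.mem_image.2 ⟨s, hs, Subsingleton.elim _ _⟩) ?_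
    rintro ⟨f, hf, h0, -⟩
    refine h0 ?_
    have h := hf 1 s hs
    rw [one_mul, eq_C_of_isEmpty f, ← mul_one (C _), derivFunctional_C_mul, derivFunctional_one,
      if_pos (Subsingleton.elim _ _), mul_one] at h
    rw [eq_C_of_isEmpty f, h, C_0]

theorem columnCount_eq_card (D : Finset (Fin 1 →₀ ℕ)) (b : Fin 0 →₀ ℕ) :
    columnCount D b = D.card := by
  rw [columnCount, Finset.filter_true_of_mem fun d _ => Subsingleton.elim _ _]

theorem hatCoeff_aeval_of_isEmpty (b : Fin 0 →₀ ℕ) (q : Polynomial k) :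
    hatCoeff b (Polynomial.aeval (X (Fin.last 0)) q) = q := by
  rw [hatCoeff, hatPoly_aeval_last, Subsingleton.elim b 0, coeff_zero_C]

theorem hatLE_of_isEmpty (b : Fin 0 →₀ ℕ) (f : MvPolynomial (Fin 1) k) : HatLE b f :=
  fun b' h => absurd (Subsingleton.elim b b' ▸ h) (lt_irrefl _)

-- In one variable there is a single column, so comparing cardinalities suffices. This makes the
-- general merging statements available for the base case.
open scoped Classical in
theorem lowerSetOf_zero_eq_fold {R : Finset (Row k 1)} (hR : IsLowerRows R) (hc : CharBound R) :
    lowerSetOf 0 R = (lastValues R).fold addLower ∅ fun c =>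
      lowerSetSpecial (fun S => S.image Prod.snd) (fibre R c) := by
  ext a
  rw [(columnClosed_fold_addLower _ _).mem_iff, columnCount_eq_card, lowerSetOf_zero,
    card_fold_lowerSetSpecial hR hc fun S _ _ => card_image_snd S]

theorem isNonLeading_lowerSetOf_zero {R : Finset (Row k 1)} (hR : IsLowerRows R)
    (hc : CharBound R) : IsNonLeading (lowerSetOf 0 R) (rowIdeal R) := by
  classical
  rw [lowerSetOf_zero_eq_fold hR hc]
  exact isNonLeading_fold_lowerSetSpecial hR hc fun S _ _ => isNonLeading_image_snd S

/-- With no first variables, a polynomial is its own coefficient at 0, so the element of the ideal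
that realises the generator is the product itself. -/
theorem prod_X_sub_C_mem_rowIdeal {R : Finset (Row k 1)} (hR : IsLowerRows R)
    (hc : CharBound R) :
    Polynomial.aeval (X (Fin.last 0)) (∏ c ∈ lastValues R,
      (Polynomial.X - Polynomial.C c) ^ (fibre R c).card) ∈ rowIdeal R := by
  classical
  obtain ⟨I, D, h⟩ := exists_isMergeState (lastValues R).nodup_toList
    fun c _ => isFibreData_rowIdeal hR hc (fun S _ _ => isNonLeading_image_snd S) c
  obtain ⟨rfl, -⟩ := h.eq_rowIdeal (lastValues R).nodup_toList fun c => Finset.mem_toList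
  obtain ⟨f, hf, -, hV⟩ := (h.control 0).2
  convert hf
  apply hatPoly_injective
  ext1 b
  refine (hatCoeff_aeval_of_isEmpty b _).trans ?_
  rw [Subsingleton.elim b 0]
  refine Eq.trans ?_ hV.symm
  simp only [Finset.prod_map_toList]
  refine Finset.prod_congr rfl fun c _ => ?_
  rw [columnCount_eq_card, card_lowerSetSpecial (fun r hr => (mem_fibre.1 hr).2)
    fun i => card_image_snd _]

theorem isReducedSet_singleton_prod {R : Finset (Row k 1)} (hR : IsLowerRows R)
    (hc : CharBound R) :
    IsReducedSet (rowIdeal R) (lowerSetOf 0 R)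
      (limitingSet (lowerSetOf 0 R : Set (Fin 1 →₀ ℕ)))
      {Polynomial.aeval (X (Fin.last 0)) (∏ c ∈ lastValues R,
        (Polynomial.X - Polynomial.C c) ^ (fibre R c).card)} := by
  set q : Polynomial k := ∏ c ∈ lastValues R,
    (Polynomial.X - Polynomial.C c) ^ (fibre R c).card with hq
  have hm : q.Monic := Polynomial.monic_prod_of_monic _ _ fun c _ =>
    (Polynomial.monic_X_sub_C c).pow _
  have hdeg : q.natDegree = R.card := by
    rw [hq, Polynomial.natDegree_prod_of_monic _ _ fun c _ => (Polynomial.monic_X_sub_C c).pow _,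
      ← sum_card_fibre]
    refine Finset.sum_congr rfl fun c _ => ?_
    rw [Polynomial.natDegree_pow, Polynomial.natDegree_X_sub_C, mul_one]
  have hne : hatCoeff 0 (Polynomial.aeval (X (Fin.last 0) : MvPolynomial (Fin 1) k) q) ≠ 0 := by
    rw [hatCoeff_aeval_of_isEmpty]
    exact hm.ne_zero
  have hd := (hatLE_of_isEmpty (k := k) 0 _).degree_eq hne
  rw [hatCoeff_aeval_of_isEmpty, hdeg] at hd
  have hnotMem : embed R.card 0 ∉ lowerSetOf 0 R := by
    rw [lowerSetOf_zero, embed_last]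
    exact lt_irrefl _
  refine ⟨?_, ?_, ?_, ?_, ?_⟩
  · rintro _ rfl
    exact prod_X_sub_C_mem_rowIdeal hR hc
  · rintro _ rfl
    rw [MonomialOrder.Monic, (hatLE_of_isEmpty 0 _).leadingCoeff_eq hne,
      hatCoeff_aeval_of_isEmpty]
    exact hm
  · rintro _ rfl
    rw [hd]
    refine ⟨hnotMem, fun i hi => ?_⟩
    rw [Subsingleton.elim i (Fin.last 0)] at hi ⊢
    rw [embed_last] at hi
    rw [embed_sub_single_last, Finset.mem_coe, lowerSetOf_zero, embed_last]
    omega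
  · rintro _ rfl e he hne'
    rw [hd] at hne'
    rw [mem_support_iff, ← embed_projHat e, ← coeff_hatCoeff, hatCoeff_aeval_of_isEmpty] at he
    have := Polynomial.le_natDegree_of_ne_zero he
    rw [lowerSetOf_zero]
    refine lt_of_le_of_ne (hdeg ▸ this) fun h => hne' ?_
    rw [← embed_projHat e, h, Subsingleton.elim (projHat e) 0]
  · intro a ha
    refine ⟨_, rfl, ?_⟩
    rw [hd]
    -- The exponent `R.card` is outside the lower set and at most any other exponent outside, so it
    -- is the only corner.
    refine eq_of_le_of_mem_limitingSet (isNonLeading_lowerSetOf_zero hR hc).isLowerSet hnotMem ha ?_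
    rw [← embed_projHat a, embed_le_embed]
    refine ⟨?_, (Subsingleton.elim _ _ : (0 : Fin 0 →₀ ℕ) = _).le⟩
    have := ha.1
    rwa [Finset.mem_coe, lowerSetOf_zero, not_lt] at this

open scoped Classical in
theorem prod_image_fst_eq_aeval (R : Finset (Row k 1)) :
    ∏ p ∈ R.image Prod.fst, (X 0 - C (p 0)) ^ (R.filter fun r => r.1 = p).card
      = Polynomial.aeval (X (Fin.last 0) : MvPolynomial (Fin 1) k) (∏ c ∈ lastValues R,
        (Polynomial.X - Polynomial.C c) ^ (fibre R c).card) := by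
  rw [map_prod]
  have hinj : Function.Injective fun p : Fin 1 → k => p (Fin.last 0) := fun p q h =>
    funext fun i => by rw [Subsingleton.elim i (Fin.last 0)]; exact h
  have hl : lastValues R = (R.image Prod.fst).image fun p => p (Fin.last 0) := by
    rw [Finset.image_image]
    rfl
  rw [hl, Finset.prod_image fun p _ q _ h => hinj h]
  refine Finset.prod_congr rfl fun p _ => ?_
  rw [aeval_X_sub_C_pow]
  have : fibre R (p (Fin.last 0)) = R.filter fun r => r.1 = p := by
    ext r
    rw [mem_fibre, Finset.mem_filter]
    exact and_congr_right fun _ => hinj.eq_iff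
  rw [this]
  rfl

end OneVariable

/-! ### Induction on the dimension and the theorem. -/

section Main

variable {k : Type*} [Field k] {n : ℕ}

theorem isNonLeading_lowerSetOf {R : Finset (Row k (n + 1))} (hR : IsLowerRows R)
    (hc : CharBound R) : IsNonLeading (lowerSetOf n R) (rowIdeal R) := by
  induction n with
  | zero => exact isNonLeading_lowerSetOf_zero hR hc
  | succ n ih => exact isNonLeading_fold_lowerSetSpecial hR hc fun S hS hcS => ih hS hcS

theorem card_lowerSetOf {R : Finset (Row k (n + 1))} (hR : IsLowerRows R)
    (hc : CharBound R) : (lowerSetOf n R).card = R.card := by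
  induction n with
  | zero =>
    classical
    rw [lowerSetOf_zero_eq_fold hR hc]
    exact card_fold_lowerSetSpecial hR hc fun S _ _ => card_image_snd S
  | succ n ih => exact card_fold_lowerSetSpecial hR hc fun S hS hcS => ih hS hcS

theorem IsPolyOf.isReducedSet {R : Finset (Row k (n + 1))} (hR : IsLowerRows R)
    (hc : CharBound R) {G : Set (MvPolynomial (Fin (n + 1)) k)} (hG : IsPolyOf n R G) :
    IsReducedSet (rowIdeal R) (lowerSetOf n R)
      (limitingSet (lowerSetOf n R : Set (Fin (n + 1) →₀ ℕ))) G := by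
  induction n with
  | zero =>
    rw [IsPolyOf, prod_image_fst_eq_aeval] at hG
    exact hG ▸ isReducedSet_singleton_prod hR hc
  | succ n ih =>
    obtain ⟨cs, hcs, hmem, Gc, hGc, hG⟩ := hG
    exact (isPolyGeneral_rowIdeal hR hc (fun S hS hcS => isNonLeading_lowerSetOf hS hcS)
      (fun S hS hcS G hG => ih hS hcS hG) hcs hmem hGc).2 G hG

theorem exists_isPolyOf {R : Finset (Row k (n + 1))} (hR : IsLowerRows R)
    (hc : CharBound R) : ∃ G, IsPolyOf n R G := by
  induction n with
  | zero => exact ⟨_, rfl⟩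
  | succ n ih =>
    have hspecial : ∀ c, ∃ G, IsPolySpecial (lowerSetOf n) (IsPolyOf n) (fibre R c) c G := by
      intro c
      choose Gt hGt using fun i => ih ((hR.fibre c).slice i) ((hc.mono (fibre_subset R c)).slice i)
      exact ⟨_, Gt, fun i _ => hGt i, rfl⟩
    choose Gc hGc using hspecial
    -- Existence of a run depends on correctness in the lower dimension: the merging steps find
    -- their multiples and remainders because the fibre outputs are reduced sets.
    obtain ⟨G, hG⟩ := (isPolyGeneral_rowIdeal hR hc
      (fun S hS hcS => isNonLeading_lowerSetOf hS hcS)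
      (fun S hS hcS G hG => hG.isReducedSet hS hcS) (lastValues R).nodup_toList
      (fun c => Finset.mem_toList) fun c _ => hGc c).1
    exact ⟨G, _, (lastValues R).nodup_toList, fun c => Finset.mem_toList, Gc, fun c _ => hGc c, hG⟩

theorem PointsWithMult.vanishingIdeal_eq (H : PointsWithMult k n) :
    H.vanishingIdeal = rowIdeal H.rows := by
  ext f
  rw [mem_rowIdeal H.isLowerRows]
  constructor
  · rintro h ⟨p, d⟩ hr
    rw [PointsWithMult.mem_rows] at hr
    exact h p hr.1 d hr.2
  · exact fun h p hp d hd => h (p, d) (PointsWithMult.mem_rows.2 ⟨hp, hd⟩)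

end Main

theorem theorem4 {k : Type*} [Field k] {n : ℕ} (H : PointsWithMult k (n + 1))
    (hk : ∀ p ∈ H.pts, ∀ d ∈ H.mult p, ∀ i, ringChar k = 0 ∨ d i < ringChar k) :
    (∃ G, H.IsPoly G) ∧
    (∀ G, H.IsPoly G →
      IsReducedGroebnerBasis MonomialOrder.lex G H.vanishingIdeal) ∧
    IsLowerSet (H.lowerSet : Set (Fin (n + 1) →₀ ℕ)) ∧
    IsQuotientBasis MonomialOrder.lex H.lowerSet H.vanishingIdeal ∧
    Module.finrank k (MvPolynomial (Fin (n + 1)) k ⧸ H.vanishingIdeal) = H.numFunctionals ∧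
    H.lowerSet.card = H.numFunctionals := by
  have hR := H.isLowerRows
  have hc : CharBound H.rows := by
    rintro ⟨p, d⟩ hr i
    rw [PointsWithMult.mem_rows] at hr
    exact hk p hr.1 d hr.2 i
  have hD : IsNonLeading H.lowerSet H.vanishingIdeal := by
    rw [H.vanishingIdeal_eq]
    exact isNonLeading_lowerSetOf hR hc
  have hcard : H.lowerSet.card = H.numFunctionals := by
    rw [← H.card_rows]
    exact card_lowerSetOf hR hc
  refine ⟨exists_isPolyOf hR hc, fun G hG => IsReducedSet.isReducedGroebnerBasis hD ?_,
    hD.isLowerSet, hD.isQuotientBasis, ?_, hcard⟩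
  · rw [H.vanishingIdeal_eq]
    exact IsPolyOf.isReducedSet hR hc hG
  · rw [hD.isQuotientBasis.finrank_eq, hcard]
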